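/- Let $M$ be a finite-dimensional paracompact smooth manifold, $\pi:TM\to M$ its tangent bundle, $\mathcal TM=TM\setminus\{0\}$, $\gamma$ the natural injection of the pullback bundle $\pi^{-1}(TM)$ over $\mathcal TM$ onto the vertical bundle of $T\mathcal TM$, $\rho=(\pi,d\pi)$, $J=\gamma\circ\rho$, $\overline\eta(u)=(u,u)$ and $\mathcal C=\gamma\overline\eta$ the Liouville vector field. Let $F:TM\to[0,\infty)$ be a Finsler structure on $M$: $F$ is continuous on $TM$, smooth on $\mathcal TM$, positively homogeneous of degree $1$ in the directional argument, and $dd_JE$, $E=\tfrac12F^2$, has maximal rank on $\mathcal TM$. Let $g(\rho W,\rho Z)=dd_JE(JW,Z)$ be its metric tensor and $G$ its geodesic spray, i.e. the spray ($G$ smooth on $\mathcal TM$, $JG=\mathcal C$, $[\mathcal C,G]=G$) with $i_G\,dd_JE=-dE$. Let $\overline\varphi$ be a concurrent $\pi$-vector field of $(M,F)$, i.e. a non-vanishing smooth section of $\pi^{-1}(TM)$ over $\mathcal TM$ with $$\nabla_{\beta\overline W}\,\overline\varphi=-\overline W=D^\circ_{\beta\overline W}\,\overline\varphi,\qquad \nabla_{\gamma\overline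 W}\,\overline\varphi=0=D^\circ_{\gamma\overline W}\,\overline\varphi$$ for all $\pi$-vector fields $\overline W$, where $\nabla$ and $D^\circ$ are the Cartan and Berwald connections of $F$ and $\beta$ is the horizontal map of the Barthel connection $[J,G]$. Put $\Phi=g(\overline\varphi,\overline\eta)$, $p^2=g(\overline\varphi,\overline\varphi)$, $\mathcal D=\{u\in\mathcal TM: F(u)>\Phi(u)\}$ and $$\widehat F=\frac{F^2}{F-\Phi}\quad\text{on }\mathcal D.$$ Assume that $\widehat F$ is a conic pseudo-Finsler structure on $\mathcal D$ (so that $dd_J(\tfrac12\widehat F^2)$ has maximal rank on $\mathcal D$), and that $F(1+2p^2)-3\Phi$ vanishes nowhere on $\mathcal D$. Then $\widehat F$ has exactly one geodesic spray $\widehat G$ on $\mathcal D$ (a smooth vector field on $\mathcal D$ with $J\widehat G=\mathcal C$, $[\mathcal C,\widehat G]=\widehat G$ and $i_{\widehat G}\,dd_J(\tfrac12\widehat F^2)=-d(\tfrac12\widehat F^2)$), namely $$\widehat G=G-f_1\,\mathcal C+f_2\,\gamma\overline\varphi,\qquad f_1=\frac{F(4\Phi-F)}{F(1+2p^2)-3\Phi},\qquad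 f_2=\frac{2F^3}{F(1+2p^2)-3\Phi}.$$ -/

import Mathlib

open Set Filter Topology Manifold ContDiff Bundle VectorField

noncomputable section

namespace Finsler

/-! ### The tangent bundle and its vertical structure -/

section TangentStructure

variable {E : Type*} [NormedAddCommGroup E] [NormedSpace ℝ E]
  {M : Type*} [TopologicalSpace M] [ChartedSpace E M] [IsManifold 𝓘(ℝ, E) ∞ M]

/-- The total space `TM` of the tangent bundle. -/
abbrev TM (E : Type*) [NormedAddCommGroup E] [NormedSpace ℝ E]
    (M : Type*) [TopologicalSpace M] [ChartedSpace E M] : Type _ :=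
  TangentBundle 𝓘(ℝ, E) M

/-- The tangent space of `TM` at `u`. -/
abbrev TTM (u : TM E M) : Type _ := TangentSpace 𝓘(ℝ, E).tangent u

/-- The fibre over `u` of the pullback of the tangent bundle along the projection `TM → M`. -/
abbrev Pull (u : TM E M) : Type _ := TangentSpace 𝓘(ℝ, E) u.proj

/-- The slit tangent bundle: the nonzero tangent vectors. -/
def slit (E : Type*) [NormedAddCommGroup E] [NormedSpace ℝ E]
    (M : Type*) [TopologicalSpace M] [ChartedSpace E M] : Set (TM E M) :=
  {u | u.snd ≠ 0}

/-- The vertical injection: `γ_u(w)` is the velocity at `t = 0` of the curve `t ↦ u + t w` in the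
fibre of `TM` through `u`. -/
def gam (u : TM E M) (w : Pull u) : TTM u :=
  mfderiv 𝓘(ℝ, ℝ) 𝓘(ℝ, E).tangent
    (fun t : ℝ => (⟨u.proj, u.snd + t • w⟩ : TM E M)) 0 (1 : ℝ)

/-- The projection `ρ_u : T_u TM → T_{π(u)} M`, the differential of `π : TM → M`. -/
def rho (u : TM E M) (a : TTM u) : Pull u :=
  mfderiv 𝓘(ℝ, E).tangent 𝓘(ℝ, E) (fun v : TM E M => v.proj) u a

/-- The vertical endomorphism `J = γ ∘ ρ`. -/
def vertJ (u : TM E M) (a : TTM u) : TTM u := gam u (rho u a)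

/-- The tautological section `η(u) = (u, u)` of the pullback bundle. -/
def eta (u : TM E M) : Pull u := u.snd

/-- The Liouville vector field `C = γ η`. -/
def liouville (u : TM E M) : TTM u := gam u (eta u)

/-- The vector field `J W`. -/
def fieldJ (W : (u : TM E M) → TTM u) (u : TM E M) : TTM u := vertJ u (W u)

/-- Smoothness at `u` of a (local) vector field on `TM`. -/
def SmoothFieldAt (W : (u : TM E M) → TTM u) (u : TM E M) : Prop :=
  ContMDiffAt 𝓘(ℝ, E).tangent 𝓘(ℝ, E).tangent.tangent ∞
    (fun v => (⟨v, W v⟩ : TangentBundle 𝓘(ℝ, E).tangent (TM E M))) u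

/-- Smoothness at `u` of a section of the pullback bundle (a `π`-vector field), viewed as a map
`TM → TM` over the identity of `M`. -/
def SmoothPiFieldAt (X : (u : TM E M) → Pull u) (u : TM E M) : Prop :=
  ContMDiffAt 𝓘(ℝ, E).tangent 𝓘(ℝ, E).tangent ∞
    (fun v => (⟨v.proj, X v⟩ : TM E M)) u

/-- The Lie bracket of vector fields on `TM`. -/
def bracket (V W : (u : TM E M) → TTM u) (u : TM E M) : TTM u :=
  mlieBracket 𝓘(ℝ, E).tangent V W u

/-- The differential at `u` of a function on `TM`. -/
def dFun (f : TM E M → ℝ) (u : TM E M) : TTM u →L[ℝ] ℝ :=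
  mfderiv 𝓘(ℝ, E).tangent 𝓘(ℝ, ℝ) f u

theorem proj_extChartAt_symm (u : TM E M) (z : E × E) :
   ((extChartAt 𝓘(ℝ, E).tangent u).symm z).proj = (extChartAt 𝓘(ℝ, E) u.proj).symm z.1 := by
  exact TangentBundle.coe_chartAt_symm_fst (I := 𝓘(ℝ, E)) z u

/-- In the preferred bundle chart at `u`, `ρ_u` is the first projection. -/
theorem rho_apply (u : TM E M) (a : TTM u) : rho u a = (show E × E from a).1 := by
  have h : HasMFDerivAt 𝓘(ℝ, E).tangent 𝓘(ℝ, E) (fun v : TM E M => v.proj) u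
      (ContinuousLinearMap.fst ℝ E E) := by
    refine ⟨(FiberBundle.continuous_proj E (TangentSpace 𝓘(ℝ, E))).continuousAt, ?_⟩
    refine HasFDerivWithinAt.congr_of_eventuallyEq (f := Prod.fst) hasFDerivWithinAt_fst ?_ ?_
    swap
    · show extChartAt 𝓘(ℝ, E) u.proj ((extChartAt 𝓘(ℝ, E).tangent u).symm (extChartAt 𝓘(ℝ, E).tangent u u)).proj = _
      rw [extChartAt_to_inv]
      rfl
    have : ((extChartAt 𝓘(ℝ, E).tangent u).target) ∈ 𝓝[range 𝓘(ℝ, E).tangent] (extChartAt 𝓘(ℝ, E).tangent u u) :=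
      extChartAt_target_mem_nhdsWithin u
    filter_upwards [this] with z hz
    have h1 : z.1 ∈ (extChartAt 𝓘(ℝ, E) u.proj).target := by
      have := (FiberBundle.extChartAt_target (IB := 𝓘(ℝ, E)) u) ▸ hz
      exact this.1.1
    show extChartAt 𝓘(ℝ, E) u.proj ((extChartAt 𝓘(ℝ, E).tangent u).symm z).proj = z.1
    rw [proj_extChartAt_symm]
    exact (extChartAt 𝓘(ℝ, E) u.proj).right_inv h1
  have := congrArg (fun L : E × E →L[ℝ] E => L a) h.mfderiv
  exact this

/-- The tangent vector of `TM` at `u` with components `(b, 0)` in the preferred bundle chart at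
`u`. It is a lift of `b`, see `rho_lift`. -/
def lift (u : TM E M) (b : Pull u) : TTM u := ((b, 0) : E × E)

theorem rho_lift (u : TM E M) (b : Pull u) : rho u (lift u b) = b := by
  rw [rho_apply]; rfl

end TangentStructure

/-! ### The exterior derivative of a 1-form -/

section ExteriorDerivative

variable {E : Type*} [NormedAddCommGroup E] [NormedSpace ℝ E]
  {H : Type*} [TopologicalSpace H] (I : ModelWithCorners ℝ E H)
  {N : Type*} [TopologicalSpace N] [ChartedSpace H N]

/-- The expression of a 1-form in the preferred chart at `p`. -/
def formInChart (α : (q : N) → TangentSpace I q → ℝ) (p : N) (z : E) (c : E) : ℝ :=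
  α ((extChartAt I p).symm z) (mfderiv 𝓘(ℝ, E) I (extChartAt I p).symm z c)

/-- The exterior derivative `dα` at `p` of a 1-form on a manifold without boundary, with the
convention `dα(X, Y) = X α(Y) - Y α(X) - α([X, Y])`; it is computed in the preferred chart
at `p`, on vector fields with constant coefficients. -/
def extD (α : (q : N) → TangentSpace I q → ℝ) (p : N) (a b : TangentSpace I p) : ℝ :=
  let a' : E := mfderiv I 𝓘(ℝ, E) (extChartAt I p) p a
  let b' : E := mfderiv I 𝓘(ℝ, E) (extChartAt I p) p b
  fderiv ℝ (fun z => formInChart I α p z b') (extChartAt I p p) a'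
    - fderiv ℝ (fun z => formInChart I α p z a') (extChartAt I p p) b'

end ExteriorDerivative

section FinslerGeometry

variable {E : Type*} [NormedAddCommGroup E] [NormedSpace ℝ E]
  {M : Type*} [TopologicalSpace M] [ChartedSpace E M] [IsManifold 𝓘(ℝ, E) ∞ M]

/-! ### Finsler structures -/

/-- The energy `F² / 2`. -/
def energy (F : TM E M → ℝ) (u : TM E M) : ℝ := F u ^ 2 / 2

/-- The 1-form `d_J f = df ∘ J`. -/
def dJ (f : TM E M → ℝ) (u : TM E M) (a : TTM u) : ℝ := dFun f u (vertJ u a)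

/-- The Hilbert 2-form `d d_J (F² / 2)`. -/
def hilbertForm (F : TM E M → ℝ) (u : TM E M) (a b : TTM u) : ℝ :=
  extD 𝓘(ℝ, E).tangent (dJ (energy F)) u a b

/-- The Hilbert 2-form has maximal rank at `u`. -/
def HilbertNondegenerateAt (F : TM E M → ℝ) (u : TM E M) : Prop :=
  ∀ a : TTM u, (∀ b : TTM u, hilbertForm F u a b = 0) → a = 0

/-- The metric tensor, `g(ρ W, ρ Z) = d d_J (F² / 2) (J W, Z)`. As the Hilbert form vanishes on pairs
of vertical vectors, any lift of `b` may be inserted for `Z`. -/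
def metric (F : TM E M → ℝ) (u : TM E M) (a b : Pull u) : ℝ :=
  hilbertForm F u (gam u a) (lift u b)

/-- A (regular) Finsler structure on `M`. -/
structure IsFinsler (F : TM E M → ℝ) : Prop where
  nonneg : ∀ u, 0 ≤ F u
  continuous : Continuous F
  smooth : ∀ u ∈ slit E M, ContMDiffAt 𝓘(ℝ, E).tangent 𝓘(ℝ, ℝ) ∞ F u
  homogeneous : ∀ (u : TM E M) (c : ℝ), 0 < c → F ⟨u.proj, c • u.snd⟩ = c * F u
  nondegenerate : ∀ u ∈ slit E M, HilbertNondegenerateAt F u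

/-- A conic pseudo-Finsler structure on `M` with conic domain `D`. -/
structure IsConicPseudoFinsler (D : Set (TM E M)) (F : TM E M → ℝ) : Prop where
  isOpen : IsOpen D
  subset_slit : D ⊆ slit E M
  conic : ∀ u ∈ D, ∀ c : ℝ, 0 < c → (⟨u.proj, c • u.snd⟩ : TM E M) ∈ D
  surjective : ∀ x : M, ∃ u ∈ D, u.proj = x
  nonneg : ∀ u ∈ D, 0 ≤ F u
  smooth : ∀ u ∈ D, ContMDiffAt 𝓘(ℝ, E).tangent 𝓘(ℝ, ℝ) ∞ F u
  homogeneous : ∀ u ∈ D, ∀ c : ℝ, 0 < c → F ⟨u.proj, c • u.snd⟩ = c * F u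
  nondegenerate : ∀ u ∈ D, HilbertNondegenerateAt F u

/-! ### Sprays -/

/-- `G` is a spray on the open set `D`: smooth, `J G = C` and `[C, G] = G`. -/
structure IsSprayOn (D : Set (TM E M)) (G : (u : TM E M) → TTM u) : Prop where
  smooth : ∀ u ∈ D, SmoothFieldAt G u
  vertJ_eq : ∀ u ∈ D, vertJ u (G u) = liouville u
  bracket_eq : ∀ u ∈ D, bracket liouville G u = G u

/-- `G` is the geodesic spray of `F` on the open set `D`: a spray with
`i_G d d_J (F² / 2) = - d (F² / 2)`. -/
structure IsGeodesicSprayOn (D : Set (TM E M)) (F : TM E M → ℝ)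
    (G : (u : TM E M) → TTM u) : Prop where
  isSpray : IsSprayOn D G
  hilbert_eq : ∀ u ∈ D, ∀ b : TTM u, hilbertForm F u (G u) b = - dFun (energy F) u b

/-! ### The Barthel, Berwald and Cartan connections

Below `G` is the geodesic spray. Sections of the pullback bundle are written `ρ W` for vector
fields `W` on `TM`, and then `γ ρ W = J W` and `β ρ W = h W`. -/

/-- The Barthel connection `Γ = [J, G]`, that is `Γ W = [J W, G] - J [W, G]`. -/
def barthel (G W : (u : TM E M) → TTM u) (u : TM E M) : TTM u :=
  bracket (fieldJ W) G u - vertJ u (bracket W G u)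

/-- The horizontal projection `h = (I + Γ) / 2`. -/
def hor (G W : (u : TM E M) → TTM u) (u : TM E M) : TTM u :=
  (1 / 2 : ℝ) • (W u + barthel G W u)

/-- The vertical projection `v = (I - Γ) / 2`. -/
def ver (G W : (u : TM E M) → TTM u) (u : TM E M) : TTM u :=
  (1 / 2 : ℝ) • (W u - barthel G W u)

/-- The Berwald derivative along `h X` satisfies `D°_{hX} ρY = V` at `u`: `γ V = v [h X, J Y]`. -/
def HasBerwaldDerivHor (G X Y : (u : TM E M) → TTM u) (u : TM E M) (V : Pull u) : Prop :=
  gam u V = ver G (bracket (hor G X) (fieldJ Y)) u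

/-- The Berwald derivative along `J X` satisfies `D°_{JX} ρY = V` at `u`: `V = ρ [J X, h Y]`. -/
def HasBerwaldDerivVer (G X Y : (u : TM E M) → TTM u) (u : TM E M) (V : Pull u) : Prop :=
  V = rho u (bracket (fieldJ X) (hor G Y) u)

/-- The function `g(ρ X, ρ Y)`. -/
def metricFun (F : TM E M → ℝ) (X Y : (u : TM E M) → TTM u) (u : TM E M) : ℝ :=
  metric F u (rho u (X u)) (rho u (Y u))

/-- The Cartan derivative along `J X` satisfies `∇_{JX} ρY = V` at `u`: for all `Z`,
`2 g(V, ρZ) = JX · g(ρY, ρZ) + g(ρY, ρ[hZ, JX]) + g(ρZ, ρ[JX, hY])`. -/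
def HasCartanDerivVer (F : TM E M → ℝ) (G X Y : (u : TM E M) → TTM u) (u : TM E M)
    (V : Pull u) : Prop :=
  ∀ Z : (u : TM E M) → TTM u, SmoothFieldAt Z u →
    2 * metric F u V (rho u (Z u)) =
      dFun (metricFun F Y Z) u (fieldJ X u)
      + metricFun F Y (bracket (hor G Z) (fieldJ X)) u
      + metricFun F Z (bracket (fieldJ X) (hor G Y)) u

/-- The Cartan derivative along `h X` satisfies `∇_{hX} ρY = V` at `u`: for all `Z`,
`2 g(V, ρZ) = hX · g(ρY, ρZ) + hY · g(ρZ, ρX) - hZ · g(ρX, ρY)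
  - g(ρX, ρ[hY, hZ]) + g(ρY, ρ[hZ, hX]) + g(ρZ, ρ[hX, hY])`. -/
def HasCartanDerivHor (F : TM E M → ℝ) (G X Y : (u : TM E M) → TTM u) (u : TM E M)
    (V : Pull u) : Prop :=
  ∀ Z : (u : TM E M) → TTM u, SmoothFieldAt Z u →
    2 * metric F u V (rho u (Z u)) =
      dFun (metricFun F Y Z) u (hor G X u)
      + dFun (metricFun F Z X) u (hor G Y u)
      - dFun (metricFun F X Y) u (hor G Z u)
      - metricFun F X (bracket (hor G Y) (hor G Z)) u
      + metricFun F Y (bracket (hor G Z) (hor G X)) u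
      + metricFun F Z (bracket (hor G X) (hor G Y)) u

/-- `φ` is a concurrent `π`-vector field of the Finsler structure `F` with geodesic spray `G`: a
smooth non-vanishing `π`-vector field on the slit tangent bundle with
`∇_{βW} φ = - W = D°_{βW} φ` and `∇_{γW} φ = 0 = D°_{γW} φ`, where `∇` and `D°` are the Cartan and
the Berwald connection of `F`. Here `Y` is any local vector field with `ρ Y = φ`. -/
structure IsConcurrent (F : TM E M → ℝ) (G : (u : TM E M) → TTM u)
    (φ : (u : TM E M) → Pull u) : Prop where
  smooth : ∀ u ∈ slit E M, SmoothPiFieldAt φ u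
  ne_zero : ∀ u ∈ slit E M, φ u ≠ 0
  deriv_eq : ∀ u ∈ slit E M, ∀ X Y : (u : TM E M) → TTM u,
    SmoothFieldAt X u → SmoothFieldAt Y u → (∀ᶠ v in 𝓝 u, rho v (Y v) = φ v) →
      HasCartanDerivHor F G X Y u (- rho u (X u)) ∧
      HasBerwaldDerivHor G X Y u (- rho u (X u)) ∧
      HasCartanDerivVer F G X Y u 0 ∧
      HasBerwaldDerivVer G X Y u 0

/-! ### The Matsumoto change -/

/-- The function `Φ = g(φ, η)`. -/
def bigPhi (F : TM E M → ℝ) (φ : (u : TM E M) → Pull u) (u : TM E M) : ℝ :=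
  metric F u (φ u) (eta u)

/-- The function `p² = g(φ, φ)`. -/
def pSq (F : TM E M → ℝ) (φ : (u : TM E M) → Pull u) (u : TM E M) : ℝ :=
  metric F u (φ u) (φ u)

/-- The conic domain on which `F > Φ`. -/
def matsumotoDomain (F : TM E M → ℝ) (φ : (u : TM E M) → Pull u) : Set (TM E M) :=
  {u | u ∈ slit E M ∧ bigPhi F φ u < F u}

/-- The `φ`-Matsumoto change `F² / (F - Φ)` of `F`. -/
def matsumoto (F : TM E M → ℝ) (φ : (u : TM E M) → Pull u) (u : TM E M) : ℝ :=
  F u ^ 2 / (F u - bigPhi F φ u)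

end FinslerGeometry

end Finsler

end

/-! Uniqueness is linear algebra: the Hilbert form of `matsumoto F φ` has trivial kernel at each
point of the domain, so the geodesic equation admits at most one value of the spray there
(`eq_of_hilbert_eq`).

Existence is a computation in bundle coordinates `(x, y)`, where `dd_J f (a, b) = D²f a (0, b₁) -
D²f b (0, a₁)` (`extD_dJ`). Since the new energy is a function of `F` and `Φ` alone, `Φ` has to be
controlled as well as `F`. Concurrence supplies this. The Berwald conditions say that the components
of `φ` depend on `x` only (`IsConcurrent.fderiv_vertical`) and fix their `x`-derivatives. Together
with the geodesic equation and `dE = 0` on horizontal vectors, this gives `G(Φ) = -F²`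
(`IsConcurrent.fderiv_bigPhi_spray`). The Cartan conditions say that `g(φ, ·)` does not depend on
`y`, and that `d_J Φ = g(φ, ρ ·)` is closed (`IsConcurrent.fderiv_fderiv_bigPhi_symm`). Moreover
`C(Φ) = Φ`, `γφ(Φ) = p²` and `F · γφ(F) = Φ`.

Insert `G - f₁ C + f₂ γφ` into the new Hilbert form and expand by the chain rule. The second
derivatives of `Φ` cancel because `d_J Φ` is closed, and those of `F` are removed by the geodesic
equation of `F`. The terms in `dF` and `dΦ` already agree by Euler's relation. What remains is a
combination of `d_J F` and `d_J Φ`; its two coefficients give linear equations for `f₁` and `f₂`,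
which the stated functions solve (`matsumoto_identity`). Finally `f₁` and `f₂` have degrees 1 and 2
in `y`, which gives `[C, Ĝ] = Ĝ` (`isSprayOn_matsumoto`). -/

noncomputable section

namespace Finsler

/-! ### Bundle coordinates on `TM`. -/

section Charts

variable {E : Type*} [NormedAddCommGroup E] [NormedSpace ℝ E]
  {M : Type*} [TopologicalSpace M] [ChartedSpace E M] [IsManifold 𝓘(ℝ, E) ∞ M]

/-- The preferred bundle chart of `TM` at `u₀`. -/
abbrev bchart (u₀ : TM E M) : PartialEquiv (TM E M) (E × E) := extChartAt 𝓘(ℝ, E).tangent u₀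

/-- The point of `TM` with given bundle coordinates. -/
def pt (u₀ : TM E M) (z : E × E) : TM E M := (bchart u₀).symm z

/-- The fibre coordinate of the bundle chart at `u₀`, a linear map on each fibre. -/
def kap (u₀ v : TM E M) : Pull v →L[ℝ] E :=
  (trivializationAt E (TangentSpace 𝓘(ℝ, E)) u₀.proj).continuousLinearMapAt ℝ v.proj

/-- The components of a tangent vector of `TM` in the bundle chart at `u₀`. -/
def coord (u₀ v : TM E M) : TTM v →L[ℝ] E × E :=
  mfderiv 𝓘(ℝ, E).tangent 𝓘(ℝ, E × E) (bchart u₀) v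

/-- The tangent vector of `TM` with given components in the bundle chart at `u₀`. -/
def push (u₀ : TM E M) (z : E × E) : E × E →L[ℝ] TTM (pt u₀ z) :=
  mfderiv 𝓘(ℝ, E × E) 𝓘(ℝ, E).tangent (bchart u₀).symm z

/-- The components of a vector field on `TM` in the bundle chart at `u₀`. -/
def rep (u₀ : TM E M) (V : (u : TM E M) → TTM u) (z : E × E) : E × E :=
  coord u₀ (pt u₀ z) (V (pt u₀ z))

/-- A function on `TM` in the bundle chart at `u₀`. -/
def frep (u₀ : TM E M) (f : TM E M → ℝ) (z : E × E) : ℝ := f (pt u₀ z)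

/-- The components of a `π`-vector field in the bundle chart at `u₀`. -/
def prep (u₀ : TM E M) (X : (u : TM E M) → Pull u) (z : E × E) : E :=
  kap u₀ (pt u₀ z) (X (pt u₀ z))

theorem isOpen_bchart_target (u₀ : TM E M) : IsOpen (bchart u₀).target :=
  isOpen_extChartAt_target u₀

theorem mem_bchart_source_iff (u₀ v : TM E M) :
    v ∈ (bchart u₀).source ↔ v.proj ∈ (chartAt E u₀.proj).source := by
  rw [extChartAt_source]
  exact TangentBundle.mem_chart_source_iff v u₀

theorem bchart_apply {u₀ v : TM E M} (hv : v.proj ∈ (chartAt E u₀.proj).source) :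
    bchart u₀ v = (extChartAt 𝓘(ℝ, E) u₀.proj v.proj, kap u₀ v v.snd) := by
  have h := FiberBundle.extChartAt (IB := 𝓘(ℝ, E)) (E := TangentSpace 𝓘(ℝ, E) (M := M)) u₀
  have h2 : bchart u₀ v = _ := congrArg (fun e => e v) (congrArg PartialEquiv.toFun h)
  rw [h2]
  refine Prod.ext ?_ ?_
  · rfl
  · have := (trivializationAt E (TangentSpace 𝓘(ℝ, E)) u₀.proj).coe_linearMapAt_of_mem
      (R := ℝ) (b := v.proj) hv
    exact (congrFun this v.snd).symm

theorem bchart_pt {u₀ : TM E M} {z : E × E} (hz : z ∈ (bchart u₀).target) :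
    bchart u₀ (pt u₀ z) = z := (bchart u₀).right_inv hz

theorem pt_mem_source {u₀ : TM E M} {z : E × E} (hz : z ∈ (bchart u₀).target) :
    pt u₀ z ∈ (bchart u₀).source := (bchart u₀).map_target hz

theorem pt_proj_mem {u₀ : TM E M} {z : E × E} (hz : z ∈ (bchart u₀).target) :
    (pt u₀ z).proj ∈ (chartAt E u₀.proj).source :=
  (mem_bchart_source_iff _ _).1 (pt_mem_source hz)

theorem pt_bchart {u₀ v : TM E M} (hv : v ∈ (bchart u₀).source) : pt u₀ (bchart u₀ v) = v :=
  (bchart u₀).left_inv hv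

theorem mem_bchart_source (u₀ : TM E M) : u₀ ∈ (bchart u₀).source := mem_extChartAt_source u₀

theorem kap_injective {u₀ v : TM E M} (hv : v.proj ∈ (chartAt E u₀.proj).source) :
    Function.Injective (kap u₀ v) := by
  intro a b hab
  have h := (trivializationAt E (TangentSpace 𝓘(ℝ, E)) u₀.proj).symmL_continuousLinearMapAt
    (R := ℝ) (b := v.proj) hv
  rw [← h a, ← h b]
  exact congrArg _ hab

theorem kap_self (u₀ : TM E M) (w : Pull u₀) : kap u₀ u₀ w = w := by
  have h : kap u₀ u₀ = mfderiv 𝓘(ℝ, E) 𝓘(ℝ, E) (extChartAt 𝓘(ℝ, E) u₀.proj) u₀.proj :=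
    TangentBundle.continuousLinearMapAt_trivializationAt (mem_chart_source E u₀.proj)
  rw [h, mfderiv_extChartAt_self]
  rfl

theorem coord_self (u₀ : TM E M) (a : TTM u₀) : coord u₀ u₀ a = a := by
  have h : coord u₀ u₀ = ContinuousLinearMap.id ℝ _ := mfderiv_extChartAt_self
  rw [h]
  rfl

theorem prep_eta {u₀ : TM E M} {z : E × E} (hz : z ∈ (bchart u₀).target) :
    prep u₀ eta z = z.2 := by
  have h := bchart_apply (pt_proj_mem hz)
  rw [bchart_pt hz] at h
  exact (congrArg Prod.snd h).symm

theorem mdifferentiableAt_bchart {u₀ v : TM E M} (hv : v ∈ (bchart u₀).source) :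
    MDifferentiableAt 𝓘(ℝ, E).tangent 𝓘(ℝ, E × E) (bchart u₀) v :=
  mdifferentiableAt_extChartAt (by rwa [extChartAt_source] at hv)

theorem contMDiffAt_pt {u₀ : TM E M} {z : E × E} (hz : z ∈ (bchart u₀).target) :
    ContMDiffAt 𝓘(ℝ, E × E) 𝓘(ℝ, E).tangent ∞ (pt u₀) z :=
  (contMDiffOn_extChartAt_symm (n := ∞) u₀).contMDiffAt
    ((isOpen_bchart_target u₀).mem_nhds hz)

theorem contMDiffAt_bchart {u₀ v : TM E M} (hv : v ∈ (bchart u₀).source) :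
    ContMDiffAt 𝓘(ℝ, E).tangent 𝓘(ℝ, E × E) ∞ (bchart u₀) v :=
  contMDiffAt_extChartAt' (by rwa [extChartAt_source] at hv)

theorem mdifferentiableAt_pt {u₀ : TM E M} {z : E × E} (hz : z ∈ (bchart u₀).target) :
    MDifferentiableAt 𝓘(ℝ, E × E) 𝓘(ℝ, E).tangent (pt u₀) z :=
  (contMDiffAt_pt hz).mdifferentiableAt (by simp)

theorem coord_push {u₀ : TM E M} {z : E × E} (hz : z ∈ (bchart u₀).target) (c : E × E) :
    coord u₀ (pt u₀ z) (push u₀ z c) = c := by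
  have h := mfderiv_comp z (mdifferentiableAt_bchart (pt_mem_source hz)) (mdifferentiableAt_pt hz)
  have h2 : (bchart u₀) ∘ (pt u₀) =ᶠ[𝓝 z] id := by
    filter_upwards [(isOpen_bchart_target u₀).mem_nhds hz] with w hw using bchart_pt hw
  rw [h2.mfderiv_eq, mfderiv_id] at h
  exact (DFunLike.congr_fun h c).symm

theorem push_coord {u₀ : TM E M} {z : E × E} (hz : z ∈ (bchart u₀).target)
    (a : TTM (pt u₀ z)) : push u₀ z (coord u₀ (pt u₀ z) a) = a := by
  have hz' : MDifferentiableAt 𝓘(ℝ, E × E) 𝓘(ℝ, E).tangent (pt u₀) (bchart u₀ (pt u₀ z)) := by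
    rw [bchart_pt hz]; exact mdifferentiableAt_pt hz
  have h := mfderiv_comp (pt u₀ z) hz' (mdifferentiableAt_bchart (pt_mem_source hz))
  have h2 : (pt u₀) ∘ (bchart u₀) =ᶠ[𝓝 (pt u₀ z)] id := by
    filter_upwards [(isOpen_extChartAt_source u₀).mem_nhds (pt_mem_source hz)] with w hw
      using pt_bchart hw
  rw [h2.mfderiv_eq, mfderiv_id] at h
  have h3 := (DFunLike.congr_fun h a).symm
  -- The base points `bchart u₀ (pt u₀ z)` and `z` agree only propositionally, and the type of the
  -- derivative depends on them; substituting a variable base point performs the transport.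
  have h4 : ∀ w, w = z → ∀ c : E × E,
    (mfderiv 𝓘(ℝ, E × E) 𝓘(ℝ, E).tangent (pt u₀) w c : E × E) = push u₀ z c := by
    rintro w rfl c; rfl
  exact (h4 _ (bchart_pt hz) _).symm.trans h3

theorem coord_injective {u₀ : TM E M} {z : E × E} (hz : z ∈ (bchart u₀).target) :
    Function.Injective (coord u₀ (pt u₀ z)) :=
  Function.LeftInverse.injective (g := push u₀ z) (push_coord hz)

theorem isInvertible_push {u₀ : TM E M} {z : E × E} (hz : z ∈ (bchart u₀).target) :
    (push u₀ z).IsInvertible :=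
  ContinuousLinearMap.IsInvertible.of_inverse (g := coord u₀ (pt u₀ z))
    (ContinuousLinearMap.ext fun a => push_coord hz a)
    (ContinuousLinearMap.ext fun a => coord_push hz a)

theorem inverse_push {u₀ : TM E M} {z : E × E} (hz : z ∈ (bchart u₀).target) :
    (push u₀ z).inverse = coord u₀ (pt u₀ z) :=
  ContinuousLinearMap.inverse_eq
    (ContinuousLinearMap.ext fun a => push_coord hz a)
    (ContinuousLinearMap.ext fun a => coord_push hz a)

end Charts

/-! ### Vertical structure, vector fields and Lie brackets in coordinates. -/

section Fields

variable {E : Type*} [NormedAddCommGroup E] [NormedSpace ℝ E]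
  {M : Type*} [TopologicalSpace M] [ChartedSpace E M] [IsManifold 𝓘(ℝ, E) ∞ M]

/-- The fibre coordinate is linear on each fibre, so affine lines in a fibre of `TM` are affine
lines in the chart. This is what makes `γ` computable and lets homogeneity be read off in
coordinates. -/
theorem pt_add_smul {u₀ : TM E M} {z : E × E} (hz : z ∈ (bchart u₀).target)
    (w : Pull (pt u₀ z)) (t : ℝ) :
    pt u₀ (z + t • ((0, kap u₀ (pt u₀ z) w) : E × E)) =
      ⟨(pt u₀ z).proj, (pt u₀ z).snd + t • w⟩ := by
  have h0 := bchart_apply (pt_proj_mem hz)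
  rw [bchart_pt hz] at h0
  set v : TM E M := ⟨(pt u₀ z).proj, (pt u₀ z).snd + t • w⟩ with hv
  have h := bchart_apply (u₀ := u₀) (v := v) (pt_proj_mem hz)
  have h1 : bchart u₀ v = z + t • ((0, kap u₀ (pt u₀ z) w) : E × E) := by
    rw [h]
    refine Prod.ext ?_ ?_
    · simp only [Prod.fst_add, Prod.smul_fst, smul_zero, add_zero]
      exact (congrArg Prod.fst h0).symm
    · have h2 : kap u₀ v v.snd = kap u₀ (pt u₀ z) (pt u₀ z).snd + t • kap u₀ (pt u₀ z) w := by
        rw [← map_smul, ← map_add]; rfl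
      refine h2.trans ?_
      exact congrArg (fun y => y + t • kap u₀ (pt u₀ z) w) (congrArg Prod.snd h0).symm
  rw [← h1]
  exact pt_bchart ((mem_bchart_source_iff _ _).2 (pt_proj_mem hz))

theorem gam_pt {u₀ : TM E M} {z : E × E} (hz : z ∈ (bchart u₀).target) (w : Pull (pt u₀ z)) :
    gam (pt u₀ z) w = push u₀ z (0, kap u₀ (pt u₀ z) w) := by
  set k : E × E := (0, kap u₀ (pt u₀ z) w) with hk
  have hline : HasDerivAt (fun t : ℝ => z + t • k) k 0 := by
    simpa using ((hasDerivAt_id (0 : ℝ)).smul_const k).const_add z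
  have h1 : HasMFDerivAt 𝓘(ℝ, ℝ) 𝓘(ℝ, E × E) (fun t : ℝ => z + t • k) 0
      (ContinuousLinearMap.toSpanSingleton ℝ k) := hline.hasFDerivAt.hasMFDerivAt
  have hz0 : z + (0 : ℝ) • k = z := by simp
  have h2 : HasMFDerivAt 𝓘(ℝ, E × E) 𝓘(ℝ, E).tangent (pt u₀) (z + (0 : ℝ) • k)
      (mfderiv 𝓘(ℝ, E × E) 𝓘(ℝ, E).tangent (pt u₀) (z + (0 : ℝ) • k)) := by
    rw [hz0]; exact (mdifferentiableAt_pt hz).hasMFDerivAt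
  have h3 := (h2.comp (0 : ℝ) h1).mfderiv
  have h4 : (pt u₀) ∘ (fun t : ℝ => z + t • k) = fun t : ℝ =>
      (⟨(pt u₀ z).proj, (pt u₀ z).snd + t • w⟩ : TM E M) := by
    funext t; exact pt_add_smul hz w t
  rw [h4] at h3
  have h5 := DFunLike.congr_fun h3 (1 : ℝ)
  have h6 : ∀ y, y = z → ∀ c : E × E,
    (mfderiv 𝓘(ℝ, E × E) 𝓘(ℝ, E).tangent (pt u₀) y c : E × E) = push u₀ z c := by
    rintro w rfl c; rfl
  have h7 : (ContinuousLinearMap.toSpanSingleton ℝ k) (1 : ℝ) = k := by simp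
  refine Eq.trans h5 (Eq.trans ?_ (h6 _ hz0 k))
  exact congrArg (fun c : E × E =>
    (mfderiv 𝓘(ℝ, E × E) 𝓘(ℝ, E).tangent (pt u₀) (z + (0 : ℝ) • k) c : E × E)) h7

theorem exists_pt_eq {u₀ v : TM E M} (hv : v ∈ (bchart u₀).source) :
    ∃ z ∈ (bchart u₀).target, pt u₀ z = v :=
  ⟨bchart u₀ v, (bchart u₀).map_source hv, pt_bchart hv⟩

theorem coord_gam {u₀ v : TM E M} (hv : v ∈ (bchart u₀).source) (w : Pull v) :
    coord u₀ v (gam v w) = (0, kap u₀ v w) := by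
  obtain ⟨z, hz, rfl⟩ := exists_pt_eq hv
  rw [gam_pt hz, coord_push hz]

/-- Differentiate the identity between the first bundle coordinate and the base chart composed with
the projection; the fibre coordinate of the trivialization is the derivative of the base chart. -/
theorem coord_fst {u₀ v : TM E M} (hv : v ∈ (bchart u₀).source) (a : TTM v) :
    (coord u₀ v a).1 = kap u₀ v (rho v a) := by
  have hv' := (mem_bchart_source_iff _ _).1 hv
  have h1 : HasMFDerivAt 𝓘(ℝ, E × E) 𝓘(ℝ, E) (Prod.fst : E × E → E) (bchart u₀ v)
      (ContinuousLinearMap.fst ℝ E E) := hasFDerivAt_fst.hasMFDerivAt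
  have h2 := (h1.comp v (mdifferentiableAt_bchart hv).hasMFDerivAt).mfderiv
  have hp : MDifferentiableAt 𝓘(ℝ, E).tangent 𝓘(ℝ, E) (fun v : TM E M => v.proj) v :=
    (contMDiff_proj (n := ∞) (TangentSpace 𝓘(ℝ, E) (M := M))).contMDiffAt.mdifferentiableAt
      (by simp)
  have h3 := mfderiv_comp v
    (mdifferentiableAt_extChartAt (I := 𝓘(ℝ, E)) hv') hp
  have h4 : (Prod.fst : E × E → E) ∘ (bchart u₀) =ᶠ[𝓝 v]
      (extChartAt 𝓘(ℝ, E) u₀.proj) ∘ (fun v : TM E M => v.proj) := by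
    filter_upwards [(isOpen_extChartAt_source u₀).mem_nhds hv] with w hw
    rw [Function.comp, bchart_apply ((mem_bchart_source_iff _ _).1 hw)]
    rfl
  rw [h4.mfderiv_eq, h3] at h2
  have h5 := DFunLike.congr_fun h2 a
  have h6 : kap u₀ v = mfderiv 𝓘(ℝ, E) 𝓘(ℝ, E) (extChartAt 𝓘(ℝ, E) u₀.proj) v.proj :=
    TangentBundle.continuousLinearMapAt_trivializationAt hv'
  rw [h6]
  exact h5.symm

theorem coord_vertJ {u₀ v : TM E M} (hv : v ∈ (bchart u₀).source) (a : TTM v) :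
    coord u₀ v (vertJ v a) = (0, (coord u₀ v a).1) := by
  rw [vertJ, coord_gam hv, coord_fst hv]

theorem rep_gam {u₀ : TM E M} {z : E × E} (hz : z ∈ (bchart u₀).target)
    (X : (u : TM E M) → Pull u) :
    rep u₀ (fun u => gam u (X u)) z = (0, prep u₀ X z) :=
  coord_gam (pt_mem_source hz) _

theorem rep_fieldJ {u₀ : TM E M} {z : E × E} (hz : z ∈ (bchart u₀).target)
    (V : (u : TM E M) → TTM u) :
    rep u₀ (fieldJ V) z = (0, (rep u₀ V z).1) :=
  coord_vertJ (pt_mem_source hz) _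

theorem rep_liouville {u₀ : TM E M} {z : E × E} (hz : z ∈ (bchart u₀).target) :
    rep u₀ liouville z = (0, z.2) := by
  rw [← prep_eta hz]
  exact rep_gam hz eta

theorem rep_fst {u₀ : TM E M} {z : E × E} (hz : z ∈ (bchart u₀).target)
    (V : (u : TM E M) → TTM u) :
    (rep u₀ V z).1 = kap u₀ (pt u₀ z) (rho (pt u₀ z) (V (pt u₀ z))) :=
  coord_fst (pt_mem_source hz) _

theorem dFun_pt {u₀ : TM E M} {z : E × E} (hz : z ∈ (bchart u₀).target) {f : TM E M → ℝ}
    (hf : MDifferentiableAt 𝓘(ℝ, E).tangent 𝓘(ℝ, ℝ) f (pt u₀ z)) (a : TTM (pt u₀ z)) :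
    dFun f (pt u₀ z) a = fderiv ℝ (frep u₀ f) z (coord u₀ (pt u₀ z) a) := by
  have h := mfderiv_comp z hf (mdifferentiableAt_pt hz)
  have h1 := DFunLike.congr_fun h (coord u₀ (pt u₀ z) a)
  have h2 := push_coord hz a
  rw [mfderiv_eq_fderiv] at h1
  refine Eq.trans (congrArg (dFun f (pt u₀ z)) h2.symm) ?_
  exact h1.symm

theorem contDiffAt_frep {u₀ : TM E M} {z : E × E} (hz : z ∈ (bchart u₀).target) {f : TM E M → ℝ}
    (hf : ContMDiffAt 𝓘(ℝ, E).tangent 𝓘(ℝ, ℝ) ∞ f (pt u₀ z)) :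
    ContDiffAt ℝ ∞ (frep u₀ f) z :=
  (ContMDiffAt.comp z hf (contMDiffAt_pt hz)).contDiffAt

theorem rep_eventuallyEq_mpullback {u₀ : TM E M} {z : E × E} (hz : z ∈ (bchart u₀).target)
    (V : (u : TM E M) → TTM u) :
    mpullback 𝓘(ℝ, E × E) 𝓘(ℝ, E).tangent (pt u₀) V =ᶠ[𝓝 z] rep u₀ V := by
  filter_upwards [(isOpen_bchart_target u₀).mem_nhds hz] with w hw
  rw [mpullback_apply]
  exact DFunLike.congr_fun (inverse_push hw) (V (pt u₀ w))

/-- The vector field on `TM` with given components in the bundle chart at `u₀`. -/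
def chartField (u₀ : TM E M) (c : E × E → E × E) : (u : TM E M) → TTM u :=
  mpullback 𝓘(ℝ, E).tangent 𝓘(ℝ, E × E) (bchart u₀) c

theorem coord_isInvertible {u₀ v : TM E M} (hv : v ∈ (bchart u₀).source) :
    (coord u₀ v).IsInvertible := isInvertible_mfderiv_extChartAt hv

theorem coord_inverse {u₀ v : TM E M} (hv : v ∈ (bchart u₀).source) (c : E × E) :
    coord u₀ v ((coord u₀ v).inverse c) = c := by
  obtain ⟨e, he⟩ := coord_isInvertible hv
  rw [← he, ContinuousLinearMap.inverse_equiv]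
  simp

theorem inverse_coord {u₀ v : TM E M} (hv : v ∈ (bchart u₀).source) (a : TTM v) :
    (coord u₀ v).inverse (coord u₀ v a) = a := by
  obtain ⟨e, he⟩ := coord_isInvertible hv
  rw [← he, ContinuousLinearMap.inverse_equiv]
  simp

theorem rep_chartField {u₀ : TM E M} {z : E × E} (hz : z ∈ (bchart u₀).target)
    (c : E × E → E × E) : rep u₀ (chartField u₀ c) z = c z := by
  have h : rep u₀ (chartField u₀ c) z = c (bchart u₀ (pt u₀ z)) :=
    coord_inverse (pt_mem_source hz) (c (bchart u₀ (pt u₀ z)))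
  rw [bchart_pt hz] at h
  exact h

theorem eventually_chartField_rep {u₀ v : TM E M} (hv : v ∈ (bchart u₀).source)
    (V : (u : TM E M) → TTM u) : ∀ᶠ w in 𝓝 v, V w = chartField u₀ (rep u₀ V) w := by
  filter_upwards [(isOpen_extChartAt_source u₀).mem_nhds hv] with w hw
  obtain ⟨z, hz, rfl⟩ := exists_pt_eq hw
  have h := inverse_coord hw (V (pt u₀ z))
  have h2 : rep u₀ V (bchart u₀ (pt u₀ z)) = coord u₀ (pt u₀ z) (V (pt u₀ z)) := by
    rw [bchart_pt hz]; rfl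
  rw [← h, ← h2]
  rfl

theorem contDiffAt_prep {u₀ : TM E M} {z : E × E} (hz : z ∈ (bchart u₀).target)
    {X : (u : TM E M) → Pull u} (hX : SmoothPiFieldAt X (pt u₀ z)) :
    ContDiffAt ℝ ∞ (prep u₀ X) z := by
  have h1 : ContMDiffAt 𝓘(ℝ, E).tangent 𝓘(ℝ, E × E) ∞
      (fun v => bchart u₀ (⟨v.proj, X v⟩ : TM E M)) (pt u₀ z) :=
    ContMDiffAt.comp (pt u₀ z) (contMDiffAt_bchart
      (v := (⟨(pt u₀ z).proj, X (pt u₀ z)⟩ : TM E M))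
      ((mem_bchart_source_iff _ _).2 (pt_proj_mem hz))) hX
  have h2 := (ContMDiffAt.comp z h1 (contMDiffAt_pt hz)).contDiffAt
  have h3 := contDiff_snd.contDiffAt.comp z h2
  refine h3.congr_of_eventuallyEq ?_
  filter_upwards [(isOpen_bchart_target u₀).mem_nhds hz] with w hw
  have := bchart_apply (u₀ := u₀) (v := (⟨(pt u₀ w).proj, X (pt u₀ w)⟩ : TM E M)) (pt_proj_mem hw)
  exact (congrArg Prod.snd this).symm

variable [CompleteSpace E]

theorem contDiffAt_rep {u₀ : TM E M} {z : E × E} (hz : z ∈ (bchart u₀).target)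
    {V : (u : TM E M) → TTM u} (hV : SmoothFieldAt V (pt u₀ z)) :
    ContDiffAt ℝ ∞ (rep u₀ V) z := by
  have h := ContMDiffAt.mpullback_vectorField_preimage (m := ∞) (n := ∞) hV
    (contMDiffAt_pt hz) (isInvertible_push hz) (by simp)
  have h2 := contMDiffAt_vectorSpace_iff_contDiffAt.1 h
  exact h2.congr_of_eventuallyEq (rep_eventuallyEq_mpullback hz V).symm

theorem smoothFieldAt_chartField {u₀ : TM E M} {z : E × E} (hz : z ∈ (bchart u₀).target)
    {c : E × E → E × E} (hc : ContDiffAt ℝ ∞ c z) : SmoothFieldAt (chartField u₀ c) (pt u₀ z) := by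
  refine ContMDiffAt.mpullback_vectorField_preimage (m := ∞) (n := ∞) ?_
    (contMDiffAt_bchart (pt_mem_source hz)) (coord_isInvertible (pt_mem_source hz)) (by simp)
  rw [bchart_pt hz]
  exact contMDiffAt_vectorSpace_iff_contDiffAt.2 hc

theorem smoothFieldAt_of_contDiffAt_rep {u₀ : TM E M} {z : E × E} (hz : z ∈ (bchart u₀).target)
    {V : (u : TM E M) → TTM u} (hV : ContDiffAt ℝ ∞ (rep u₀ V) z) :
    SmoothFieldAt V (pt u₀ z) := by
  refine ContMDiffAt.congr_of_eventuallyEq (smoothFieldAt_chartField hz hV) ?_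
  filter_upwards [eventually_chartField_rep (pt_mem_source hz) V] with w hw
  rw [← hw]

/-- Naturality of the Lie bracket under pullback by the inverse chart; `rep` is locally such a
pullback. -/
theorem rep_bracket {u₀ : TM E M} {z : E × E} (hz : z ∈ (bchart u₀).target)
    {V W : (u : TM E M) → TTM u} (hV : SmoothFieldAt V (pt u₀ z))
    (hW : SmoothFieldAt W (pt u₀ z)) :
    rep u₀ (bracket V W) z = lieBracket ℝ (rep u₀ V) (rep u₀ W) z := by
  have : IsManifold 𝓘(ℝ, E).tangent (minSmoothness ℝ 3) (TM E M) := by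
    rw [minSmoothness_of_isRCLikeNormedField]
    exact IsManifold.of_le (n := ∞) (WithTop.coe_le_coe.2 (le_top : (3 : ℕ∞) ≤ ⊤))
  have h := mpullback_mlieBracket (n := ∞) (hV.mdifferentiableAt (by simp))
    (hW.mdifferentiableAt (by simp)) (contMDiffAt_pt hz)
    (by rw [minSmoothness_of_isRCLikeNormedField]; exact WithTop.coe_le_coe.2 (le_top : (2 : ℕ∞) ≤ ⊤))
  have h1 := (rep_eventuallyEq_mpullback hz (bracket V W)).self_of_nhds
  have h2 := (rep_eventuallyEq_mpullback hz V).mlieBracket_vectorField_eq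
    (rep_eventuallyEq_mpullback hz W)
  have h3 := congrFun (mlieBracketWithin_eq_lieBracketWithin (𝕜 := ℝ)
    (V := rep u₀ V) (W := rep u₀ W) (s := univ)) z
  exact h1.symm.trans (h.trans (h2.trans (h3.trans (congrFun lieBracketWithin_univ z))))

end Fields

/-! ### Calculus of second derivatives. -/

section SecondDerivative

variable {V W : Type*} [NormedAddCommGroup V] [NormedSpace ℝ V]
  [NormedAddCommGroup W] [NormedSpace ℝ W]

theorem _root_.ContDiffAt.eventually_differentiableAt {f : V → W} {z : V}
    (hf : ContDiffAt ℝ ∞ f z) : ∀ᶠ y in 𝓝 z, DifferentiableAt ℝ f y := by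
  have h : ContDiffAt ℝ 1 f z := hf.of_le (by simp)
  filter_upwards [h.eventually (by simp)] with y hy using hy.differentiableAt (by simp)

theorem _root_.ContDiffAt.fderiv_infty {f : V → W} {z : V} (hf : ContDiffAt ℝ ∞ f z) :
    ContDiffAt ℝ ∞ (fderiv ℝ f) z := hf.fderiv_right (by simp)

theorem _root_.ContDiffAt.differentiableAt_fderiv {f : V → W} {z : V} (hf : ContDiffAt ℝ ∞ f z) :
    DifferentiableAt ℝ (fderiv ℝ f) z := hf.fderiv_infty.differentiableAt (by simp)

theorem fderiv_fderiv_apply {f : V → W} {z : V} (hf : ContDiffAt ℝ ∞ f z) {c : V → V}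
    (hc : DifferentiableAt ℝ c z) (a : V) :
    fderiv ℝ (fun y => fderiv ℝ f y (c y)) z a =
      fderiv ℝ (fderiv ℝ f) z a (c z) + fderiv ℝ f z (fderiv ℝ c z a) := by
  rw [(hf.differentiableAt_fderiv.hasFDerivAt.clm_apply hc.hasFDerivAt).fderiv]
  simp [add_comm]

theorem fderiv_fderiv_const {f : V → W} {z : V} (hf : ContDiffAt ℝ ∞ f z) (a c : V) :
    fderiv ℝ (fun y => fderiv ℝ f y c) z a = fderiv ℝ (fderiv ℝ f) z a c := by
  rw [fderiv_fderiv_apply hf (differentiableAt_const c)]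
  simp

theorem fderiv_fderiv_symm {f : V → W} {z : V} (hf : ContDiffAt ℝ ∞ f z) (a b : V) :
    fderiv ℝ (fderiv ℝ f) z a b = fderiv ℝ (fderiv ℝ f) z b a :=
  (hf.isSymmSndFDerivAt (by
    rw [minSmoothness_of_isRCLikeNormedField]
    exact WithTop.coe_le_coe.2 (le_top : (2 : ℕ∞) ≤ ⊤))).eq a b

theorem fderiv_pair {X : V → W} {Y : V → W} {H : V → W × W} {z : V}
    (hX : DifferentiableAt ℝ X z) (hY : DifferentiableAt ℝ Y z)
    (hH : H =ᶠ[𝓝 z] fun y => (X y, Y y)) (a : V) :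
    fderiv ℝ H z a = (fderiv ℝ X z a, fderiv ℝ Y z a) := by
  rw [hH.fderiv_eq, hX.fderiv_prodMk hY]
  rfl

end SecondDerivative

/-! ### The form `dd_J f` and fibre Hessians in coordinates. -/

section HilbertForm

variable {E : Type*} [NormedAddCommGroup E] [NormedSpace ℝ E]
  {M : Type*} [TopologicalSpace M] [ChartedSpace E M] [IsManifold 𝓘(ℝ, E) ∞ M]

/-- The domain of the bundle chart at `u₀` in the slit tangent bundle, in coordinates. -/
def slitDom (u₀ : TM E M) : Set (E × E) := (bchart u₀).target ∩ {z | z.2 ≠ 0}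

theorem isOpen_slitDom (u₀ : TM E M) : IsOpen (slitDom u₀) :=
  (isOpen_bchart_target u₀).inter (isOpen_ne.preimage continuous_snd)

theorem pt_mem_slit {u₀ : TM E M} {z : E × E} (hz : z ∈ slitDom u₀) : pt u₀ z ∈ slit E M := by
  intro h
  apply hz.2
  rw [← prep_eta hz.1]
  change kap u₀ (pt u₀ z) (pt u₀ z).snd = 0
  rw [h, map_zero]

theorem bchart_self_mem_slitDom {u₀ : TM E M} (hu : u₀ ∈ slit E M) :
    bchart u₀ u₀ ∈ slitDom u₀ := by
  refine ⟨(bchart u₀).map_source (mem_bchart_source u₀), ?_⟩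
  have h := bchart_apply (u₀ := u₀) (v := u₀) (mem_chart_source E u₀.proj)
  rw [kap_self] at h
  rw [mem_ofPred_eq, h]
  exact hu

theorem pt_bchart_self (u₀ : TM E M) : pt u₀ (bchart u₀ u₀) = u₀ :=
  pt_bchart (mem_bchart_source u₀)

theorem isOpen_slit : IsOpen (slit E M) := by
  rw [isOpen_iff_mem_nhds]
  intro u hu
  have h1 : (bchart u) ⁻¹' (slitDom u) ∈ 𝓝 u :=
    (contMDiffAt_bchart (mem_bchart_source u)).continuousAt
      ((isOpen_slitDom u).mem_nhds (bchart_self_mem_slitDom hu))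
  filter_upwards [h1, (isOpen_extChartAt_source (I := 𝓘(ℝ, E).tangent) u).mem_nhds
    (mem_bchart_source u)] with v hv hv'
  rw [← pt_bchart hv']
  exact pt_mem_slit hv

theorem contMDiffAt_of_frep {u₀ : TM E M} {z : E × E} (hz : z ∈ (bchart u₀).target)
    {f : TM E M → ℝ} (hf : ContDiffAt ℝ ∞ (frep u₀ f) z) :
    ContMDiffAt 𝓘(ℝ, E).tangent 𝓘(ℝ, ℝ) ∞ f (pt u₀ z) := by
  have h : ContMDiffAt 𝓘(ℝ, E).tangent 𝓘(ℝ, ℝ) ∞ (frep u₀ f ∘ bchart u₀) (pt u₀ z) := by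
    refine ContMDiffAt.comp (pt u₀ z) ?_ (contMDiffAt_bchart (pt_mem_source hz))
    rw [bchart_pt hz]
    exact hf.contMDiffAt
  refine h.congr_of_eventuallyEq ?_
  filter_upwards [(isOpen_extChartAt_source (I := 𝓘(ℝ, E).tangent) u₀).mem_nhds
    (pt_mem_source hz)] with v hv
  exact congrArg f (pt_bchart hv).symm

theorem extD_dJ {u₀ : TM E M} {f : TM E M → ℝ}
    (hf : ∀ᶠ v in 𝓝 u₀, ContMDiffAt 𝓘(ℝ, E).tangent 𝓘(ℝ, ℝ) ∞ f v) (a b : TTM u₀) :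
    extD 𝓘(ℝ, E).tangent (dJ f) u₀ a b =
      fderiv ℝ (fderiv ℝ (frep u₀ f)) (bchart u₀ u₀) (coord u₀ u₀ a) (0, (coord u₀ u₀ b).1)
      - fderiv ℝ (fderiv ℝ (frep u₀ f)) (bchart u₀ u₀) (coord u₀ u₀ b)
          (0, (coord u₀ u₀ a).1) := by
  set z₀ := bchart u₀ u₀ with hz₀
  have hz : z₀ ∈ (bchart u₀).target := (bchart u₀).map_source (mem_bchart_source u₀)
  have hcont : Tendsto (pt u₀) (𝓝 z₀) (𝓝 u₀) := by
    have := (contMDiffAt_pt hz).continuousAt.tendsto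
    rwa [pt_bchart_self] at this
  -- In coordinates `J` sends `(c₁, c₂)` to `(0, c₁)`, so `d_J f` on a constant field is the
  -- derivative of `f` along the constant vertical vector `(0, c₁)`.
  have key : ∀ c : E × E,
      (fun z => formInChart 𝓘(ℝ, E).tangent (dJ f) u₀ z c) =ᶠ[𝓝 z₀]
        fun z => fderiv ℝ (frep u₀ f) z (0, c.1) := by
    intro c
    filter_upwards [(isOpen_bchart_target u₀).mem_nhds hz, hcont.eventually hf] with z hz hfz
    have h1 : formInChart 𝓘(ℝ, E).tangent (dJ f) u₀ z c =
      dFun f (pt u₀ z) (vertJ (pt u₀ z) (push u₀ z c)) := rfl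
    rw [h1, dFun_pt hz (hfz.mdifferentiableAt (by simp)), coord_vertJ (pt_mem_source hz),
      coord_push hz]
  have hfz : ContDiffAt ℝ ∞ (frep u₀ f) z₀ := by
    refine contDiffAt_frep hz ?_
    rw [pt_bchart_self]
    exact hf.self_of_nhds
  have h2 : ∀ c d : E × E, fderiv ℝ (fun z => formInChart 𝓘(ℝ, E).tangent (dJ f) u₀ z c) z₀ d =
      fderiv ℝ (fderiv ℝ (frep u₀ f)) z₀ d (0, c.1) := by
    intro c d
    rw [(key c).fderiv_eq, fderiv_fderiv_const hfz]
  have h3 := h2 (coord u₀ u₀ b) (coord u₀ u₀ a)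
  have h4 := h2 (coord u₀ u₀ a) (coord u₀ u₀ b)
  exact congrArg₂ (· - ·) h3 h4

/-- The right side is the Hessian along the fibre, a vector space, so it involves no chart. `metric`
is defined through the chart at the point itself; this identity transfers it to one fixed chart,
where it can be differentiated. -/
theorem fderiv_fderiv_fibre {u₀ v : TM E M} (hv : v ∈ (bchart u₀).source) {f : TM E M → ℝ}
    (hf : ContDiffAt ℝ ∞ (frep u₀ f) (bchart u₀ v)) (a b : Pull v) :
    fderiv ℝ (fderiv ℝ (frep u₀ f)) (bchart u₀ v) (0, kap u₀ v a) (0, kap u₀ v b) =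
      fderiv ℝ (fderiv ℝ (fun w : E => f ⟨v.proj, w⟩)) (show E from v.snd) a b := by
  obtain ⟨z, hz, rfl⟩ := exists_pt_eq hv
  rw [bchart_pt hz] at hf ⊢
  let κ : E →L[ℝ] E := kap u₀ (pt u₀ z)
  let L : E → E × E := fun w => (z.1, κ w)
  let w₀ : E := (pt u₀ z).snd
  have hL : ∀ w, HasFDerivAt L ((0 : E →L[ℝ] E).prod κ) w := fun w =>
    (hasFDerivAt_const z.1 w).prodMk κ.hasFDerivAt
  have hL0 : L w₀ = z := Prod.ext rfl (prep_eta hz)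
  have hfL : (fun w : E => f ⟨(pt u₀ z).proj, w⟩) = fun w => frep u₀ f (L w) := by
    funext w
    have h := pt_add_smul hz (show Pull (pt u₀ z) from w - w₀) 1
    have h2 : z + (1 : ℝ) • ((0, kap u₀ (pt u₀ z) (w - w₀)) : E × E) = L w := by
      rw [← hL0]
      refine Prod.ext ?_ ?_
      · simp [L]
      · have : κ (w - w₀) = κ w - κ w₀ := map_sub _ _ _
        change κ w₀ + (1 : ℝ) • κ (w - w₀) = κ w
        rw [this, one_smul]; abel
    have h3 : (⟨(pt u₀ z).proj, w⟩ : TM E M) = pt u₀ (L w) := by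
      rw [← h2, h]
      congr 1
      change w = w₀ + (1 : ℝ) • (w - w₀)
      rw [one_smul]; abel
    exact congrArg f h3
  have hLt : Tendsto L (𝓝 w₀) (𝓝 z) := by
    have := (hL w₀).continuousAt.tendsto
    rwa [hL0] at this
  have hD : fderiv ℝ (fun w => frep u₀ f (L w)) =ᶠ[𝓝 w₀]
      fun w => (fderiv ℝ (frep u₀ f) (L w)).comp ((0 : E →L[ℝ] E).prod κ) := by
    filter_upwards [hLt.eventually hf.eventually_differentiableAt] with w hw
    exact (hw.hasFDerivAt.comp w (hL w)).fderiv
  have hD2 : HasFDerivAt (fun w => fderiv ℝ (frep u₀ f) (L w))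
      ((fderiv ℝ (fderiv ℝ (frep u₀ f)) z).comp ((0 : E →L[ℝ] E).prod κ)) w₀ := by
    refine HasFDerivAt.comp w₀ ?_ (hL w₀)
    rw [hL0]
    exact hf.differentiableAt_fderiv.hasFDerivAt
  have h5 := (hD2.clm_comp (hasFDerivAt_const ((0 : E →L[ℝ] E).prod κ) w₀)).fderiv
  rw [hfL, hD.fderiv_eq]
  have h6 := DFunLike.congr_fun (DFunLike.congr_fun h5 a) b
  refine Eq.trans ?_ h6.symm
  simp
  rfl

end HilbertForm

/-! ### Metric, Euler relations, sprays and the Barthel connection in coordinates. -/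

section FinslerCharts

variable {E : Type*} [NormedAddCommGroup E] [NormedSpace ℝ E]
  {M : Type*} [TopologicalSpace M] [ChartedSpace E M] [IsManifold 𝓘(ℝ, E) ∞ M]

theorem contMDiffAt_energy {F : TM E M → ℝ} {u : TM E M}
    (hF : ContMDiffAt 𝓘(ℝ, E).tangent 𝓘(ℝ, ℝ) ∞ F u) :
    ContMDiffAt 𝓘(ℝ, E).tangent 𝓘(ℝ, ℝ) ∞ (energy F) u := by
  have h : ContDiff ℝ ∞ (fun x : ℝ => x ^ 2 / 2) := by fun_prop
  exact h.contMDiff.contMDiffAt.comp u hF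

theorem IsFinsler.contDiffAt {F : TM E M → ℝ} (hF : IsFinsler F) {u₀ : TM E M} {z : E × E}
    (hz : z ∈ slitDom u₀) : ContDiffAt ℝ ∞ (frep u₀ F) z :=
  contDiffAt_frep hz.1 (hF.smooth _ (pt_mem_slit hz))

theorem IsFinsler.contDiffAt_energy {F : TM E M → ℝ} (hF : IsFinsler F) {u₀ : TM E M}
    {z : E × E} (hz : z ∈ slitDom u₀) : ContDiffAt ℝ ∞ (frep u₀ (energy F)) z :=
  contDiffAt_frep hz.1 (contMDiffAt_energy (hF.smooth _ (pt_mem_slit hz)))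

theorem hilbertForm_eq {F : TM E M → ℝ} {u₀ : TM E M}
    (hf : ∀ᶠ v in 𝓝 u₀, ContMDiffAt 𝓘(ℝ, E).tangent 𝓘(ℝ, ℝ) ∞ F v) (a b : TTM u₀) :
    hilbertForm F u₀ a b =
      fderiv ℝ (fderiv ℝ (frep u₀ (energy F))) (bchart u₀ u₀) (coord u₀ u₀ a)
        (0, (coord u₀ u₀ b).1)
      - fderiv ℝ (fderiv ℝ (frep u₀ (energy F))) (bchart u₀ u₀) (coord u₀ u₀ b)
          (0, (coord u₀ u₀ a).1) :=
  extD_dJ (hf.mono fun _ => contMDiffAt_energy) a b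

theorem hilbertForm_self (F : TM E M → ℝ) (u : TM E M) (a : TTM u) : hilbertForm F u a a = 0 :=
  sub_self _

theorem IsFinsler.metric_eq {F : TM E M → ℝ} (hF : IsFinsler F) {u₀ v : TM E M}
    (hv : v ∈ (bchart u₀).source) (hs : v ∈ slit E M) (a b : Pull v) :
    metric F v a b = fderiv ℝ (fderiv ℝ (frep u₀ (energy F))) (bchart u₀ v)
      (0, kap u₀ v a) (0, kap u₀ v b) := by
  have h1 : ContDiffAt ℝ ∞ (frep u₀ (energy F)) (bchart u₀ v) := by
    refine contDiffAt_frep ((bchart u₀).map_source hv) ?_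
    rw [pt_bchart hv]
    exact Finsler.contMDiffAt_energy (hF.smooth v hs)
  have h2 : ContDiffAt ℝ ∞ (frep v (energy F)) (bchart v v) := by
    refine contDiffAt_frep ((bchart v).map_source (mem_bchart_source v)) ?_
    rw [pt_bchart_self]
    exact Finsler.contMDiffAt_energy (hF.smooth v hs)
  rw [fderiv_fderiv_fibre hv h1, ← fderiv_fderiv_fibre (mem_bchart_source v) h2]
  have h3 : coord v v (gam v a) = (0, kap v v a) := coord_gam (mem_bchart_source v) a
  have h4 : (coord v v (lift v b)).1 = kap v v b := by
    rw [coord_fst (mem_bchart_source v), rho_lift]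
  have h5 := hilbertForm_eq (F := F) (u₀ := v)
    (by filter_upwards [isOpen_slit.mem_nhds hs] with w hw using hF.smooth w hw)
    (gam v a) (lift v b)
  rw [metric, h5, h3, h4]
  -- One argument is vertical, so the second term of the Hilbert form drops out.
  have h6 : ((0, (0, kap v v a).1) : E × E) = 0 := rfl
  rw [h6, map_zero, sub_zero]

theorem IsFinsler.metric_pt {F : TM E M → ℝ} (hF : IsFinsler F) {u₀ : TM E M} {z : E × E}
    (hz : z ∈ slitDom u₀) (a b : Pull (pt u₀ z)) :
    metric F (pt u₀ z) a b = fderiv ℝ (fderiv ℝ (frep u₀ (energy F))) z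
      (0, kap u₀ (pt u₀ z) a) (0, kap u₀ (pt u₀ z) b) := by
  rw [hF.metric_eq (pt_mem_source hz.1) (pt_mem_slit hz), bchart_pt hz.1]

theorem IsFinsler.metricFun_pt {F : TM E M → ℝ} (hF : IsFinsler F) {u₀ : TM E M} {z : E × E}
    (hz : z ∈ slitDom u₀) (X Y : (u : TM E M) → TTM u) :
    metricFun F X Y (pt u₀ z) = fderiv ℝ (fderiv ℝ (frep u₀ (energy F))) z
      (0, (rep u₀ X z).1) (0, (rep u₀ Y z).1) := by
  rw [metricFun, hF.metric_pt hz, rep_fst hz.1, rep_fst hz.1]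

theorem pt_smul {u₀ : TM E M} {z : E × E} (hz : z ∈ (bchart u₀).target) (c : ℝ) :
    pt u₀ (z.1, c • z.2) = ⟨(pt u₀ z).proj, c • (pt u₀ z).snd⟩ := by
  have h := pt_add_smul hz (pt u₀ z).snd (c - 1)
  have h1 : kap u₀ (pt u₀ z) (pt u₀ z).snd = z.2 := prep_eta hz
  have h2 : z + (c - 1) • ((0, kap u₀ (pt u₀ z) (pt u₀ z).snd) : E × E) = (z.1, c • z.2) := by
    rw [h1]
    refine Prod.ext ?_ ?_
    · simp
    · simp [sub_smul]
  have h3 : (pt u₀ z).snd + (c - 1) • (pt u₀ z).snd = c • (pt u₀ z).snd := by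
    rw [sub_smul, one_smul]; abel
  rw [h2, h3] at h
  exact h

theorem IsFinsler.fderiv_radial {F : TM E M → ℝ} (hF : IsFinsler F) {u₀ : TM E M} {z : E × E}
    (hz : z ∈ slitDom u₀) : fderiv ℝ (frep u₀ F) z (0, z.2) = frep u₀ F z := by
  have hL : HasDerivAt (fun c : ℝ => (z.1, c • z.2)) (0, z.2) 1 :=
    (hasDerivAt_const (1 : ℝ) z.1).prodMk (by simpa using (hasDerivAt_id (1 : ℝ)).smul_const z.2)
  have h1 : (fun c : ℝ => (z.1, c • z.2)) 1 = z := by simp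
  have hd : HasFDerivAt (frep u₀ F) (fderiv ℝ (frep u₀ F) z) ((fun c : ℝ => (z.1, c • z.2)) 1) := by
    rw [h1]
    exact ((hF.contDiffAt hz).differentiableAt (by simp)).hasFDerivAt
  have h2 := hd.comp_hasDerivAt (1 : ℝ) hL
  -- Homogeneity holds for positive factors only, hence on a neighbourhood of `c = 1`, which
  -- suffices for Euler's relation.
  have h3 : (frep u₀ F ∘ fun c : ℝ => (z.1, c • z.2)) =ᶠ[𝓝 1] fun c => c * frep u₀ F z := by
    filter_upwards [lt_mem_nhds (zero_lt_one' ℝ)] with c hc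
    rw [Function.comp, frep, pt_smul hz.1, hF.homogeneous _ _ hc]
    rfl
  have h4 : HasDerivAt (fun c : ℝ => c * frep u₀ F z) (frep u₀ F z) 1 := by
    simpa using (hasDerivAt_id (1 : ℝ)).mul_const (frep u₀ F z)
  exact h2.unique (h4.congr_of_eventuallyEq h3)

theorem fderiv_energy {F : TM E M → ℝ} {u₀ : TM E M} {z : E × E}
    (hF : DifferentiableAt ℝ (frep u₀ F) z) (a : E × E) :
    fderiv ℝ (frep u₀ (energy F)) z a = frep u₀ F z * fderiv ℝ (frep u₀ F) z a := by
  have h : HasFDerivAt (frep u₀ (energy F))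
      (((2 : ℝ)⁻¹ • (2 * frep u₀ F z ^ 1) • fderiv ℝ (frep u₀ F) z)) z := by
    have h1 := (hF.hasFDerivAt.pow 2).const_mul (2 : ℝ)⁻¹
    refine (h1.congr_of_eventuallyEq (Eventually.of_forall fun y => ?_)).congr_fderiv ?_
    · simp only [frep, energy]; ring
    · ext a <;> simp
  rw [h.fderiv]
  simp
  ring

theorem IsFinsler.fderiv_energy_radial {F : TM E M → ℝ} (hF : IsFinsler F) {u₀ : TM E M}
    {z : E × E} (hz : z ∈ slitDom u₀) :
    fderiv ℝ (frep u₀ (energy F)) z (0, z.2) = 2 * frep u₀ (energy F) z := by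
  rw [fderiv_energy ((hF.contDiffAt hz).differentiableAt (by simp)), hF.fderiv_radial hz]
  simp only [frep, energy]; ring

theorem contDiffAt_liouville {u₀ : TM E M} {z : E × E} (hz : z ∈ (bchart u₀).target) :
    ContDiffAt ℝ ∞ (rep u₀ liouville) z := by
  have h : ContDiffAt ℝ ∞ (fun z : E × E => ((0, z.2) : E × E)) z :=
    contDiffAt_const.prodMk contDiffAt_snd
  refine h.congr_of_eventuallyEq ?_
  filter_upwards [(isOpen_bchart_target u₀).mem_nhds hz] with y hy using rep_liouville hy

theorem rep_fst_of_vertJ {u₀ : TM E M} {z : E × E} (hz : z ∈ (bchart u₀).target)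
    {V : (u : TM E M) → TTM u} :
    vertJ (pt u₀ z) (V (pt u₀ z)) = liouville (pt u₀ z) ↔ (rep u₀ V z).1 = z.2 := by
  rw [← (coord_injective hz).eq_iff, coord_vertJ (pt_mem_source hz)]
  change _ = rep u₀ liouville z ↔ _
  rw [rep_liouville hz]
  simp [rep]

theorem rep_fieldJ_eventuallyEq {u₀ : TM E M} {z : E × E} (hz : z ∈ (bchart u₀).target)
    (V : (u : TM E M) → TTM u) :
    rep u₀ (fieldJ V) =ᶠ[𝓝 z] fun y => (0, (rep u₀ V y).1) := by
  filter_upwards [(isOpen_bchart_target u₀).mem_nhds hz] with y hy using rep_fieldJ hy V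

theorem IsSprayOn.rep_fst {D : Set (TM E M)} {G : (u : TM E M) → TTM u} (hG : IsSprayOn D G)
    {u₀ : TM E M} {z : E × E} (hz : z ∈ (bchart u₀).target) (hD : pt u₀ z ∈ D) :
    (rep u₀ G z).1 = z.2 := (rep_fst_of_vertJ hz).1 (hG.vertJ_eq _ hD)

variable [CompleteSpace E]

theorem rep_bracket_liouville {u₀ : TM E M} {z : E × E} (hz : z ∈ (bchart u₀).target)
    {V : (u : TM E M) → TTM u} (hV : SmoothFieldAt V (pt u₀ z)) :
    rep u₀ (bracket liouville V) z =
      fderiv ℝ (rep u₀ V) z (0, z.2) - (0, (rep u₀ V z).2) := by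
  rw [rep_bracket hz (smoothFieldAt_of_contDiffAt_rep hz (contDiffAt_liouville hz)) hV,
    lieBracket, rep_liouville hz]
  have h : rep u₀ liouville =ᶠ[𝓝 z] fun y => ((fun _ => 0) y, Prod.snd y) := by
    filter_upwards [(isOpen_bchart_target u₀).mem_nhds hz] with y hy using rep_liouville hy
  rw [fderiv_pair (differentiableAt_const 0) differentiableAt_snd h]
  simp [fderiv_snd]

/-- The second component of `[C, G] = G`: bracketing with `C` subtracts the fibre component once, so
Euler's relation holds with degree 2. -/
theorem IsSprayOn.fderiv_radial {D : Set (TM E M)} {G : (u : TM E M) → TTM u}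
    (hG : IsSprayOn D G) {u₀ : TM E M} {z : E × E} (hz : z ∈ (bchart u₀).target)
    (hD : pt u₀ z ∈ D) :
    fderiv ℝ (fun y => (rep u₀ G y).2) z (0, z.2) = (2 : ℝ) • (rep u₀ G z).2 := by
  have h1 := congrArg (coord u₀ (pt u₀ z)) (hG.bracket_eq _ hD)
  change rep u₀ (bracket liouville G) z = rep u₀ G z at h1
  rw [rep_bracket_liouville hz (hG.smooth _ hD)] at h1
  have hd : DifferentiableAt ℝ (rep u₀ G) z :=
    (contDiffAt_rep hz (hG.smooth _ hD)).differentiableAt (by simp)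
  rw [fderiv_pair hd.fst hd.snd (Eventually.of_forall fun y => rfl)] at h1
  have h2 := congrArg Prod.snd h1
  simp only [Prod.snd_sub] at h2
  rw [two_smul, ← sub_eq_iff_eq_add.1 h2]

theorem smoothFieldAt_fieldJ {u₀ : TM E M} {z : E × E} (hz : z ∈ (bchart u₀).target)
    {V : (u : TM E M) → TTM u} (hV : SmoothFieldAt V (pt u₀ z)) :
    SmoothFieldAt (fieldJ V) (pt u₀ z) := by
  refine smoothFieldAt_of_contDiffAt_rep hz ?_
  refine ContDiffAt.congr_of_eventuallyEq ?_ (rep_fieldJ_eventuallyEq hz V)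
  exact contDiffAt_const.prodMk (contDiffAt_rep hz hV).fst

/-- In `[JV, G] - J[V, G]` the derivatives of `V` along `G` cancel, so the value depends on `V` only
at the point. This is why `h` and `v` are tensorial. -/
theorem rep_barthel {G : (u : TM E M) → TTM u} (hG : IsSprayOn (slit E M) G)
    {u₀ : TM E M} {z : E × E} (hz : z ∈ slitDom u₀)
    {V : (u : TM E M) → TTM u} (hV : SmoothFieldAt V (pt u₀ z)) :
    rep u₀ (barthel G V) z = ((rep u₀ V z).1,
      fderiv ℝ (fun y => (rep u₀ G y).2) z (0, (rep u₀ V z).1) - (rep u₀ V z).2) := by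
  have hGz := hG.smooth _ (pt_mem_slit hz)
  have hdG : DifferentiableAt ℝ (rep u₀ G) z :=
    (contDiffAt_rep hz.1 hGz).differentiableAt (by simp)
  have hdV : DifferentiableAt ℝ (rep u₀ V) z :=
    (contDiffAt_rep hz.1 hV).differentiableAt (by simp)
  have h1 : rep u₀ (barthel G V) z =
      rep u₀ (bracket (fieldJ V) G) z - (0, (rep u₀ (bracket V G) z).1) := by
    have := coord_vertJ (pt_mem_source hz.1) (bracket V G (pt u₀ z))
    change coord u₀ (pt u₀ z) (_ - _) = _
    rw [map_sub, this]
    rfl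
  have hGpair : rep u₀ G =ᶠ[𝓝 z] fun y => (y.2, (rep u₀ G y).2) := by
    filter_upwards [(isOpen_slitDom u₀).mem_nhds hz] with y hy
    exact Prod.ext (hG.rep_fst hy.1 (pt_mem_slit hy)) rfl
  rw [h1, rep_bracket hz.1 (smoothFieldAt_fieldJ hz.1 hV) hGz, rep_bracket hz.1 hV hGz,
    lieBracket, lieBracket, rep_fieldJ hz.1,
    fderiv_pair (differentiableAt_const 0) hdV.fst (rep_fieldJ_eventuallyEq hz.1 V),
    fderiv_pair differentiableAt_snd hdG.snd hGpair,
    fderiv_pair differentiableAt_snd hdG.snd hGpair,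
    fderiv_pair hdV.fst hdV.snd (Eventually.of_forall fun y => rfl)]
  refine Prod.ext ?_ ?_
  · simp [fderiv_snd]
  · simp [fderiv_snd]

theorem rep_hor {G : (u : TM E M) → TTM u} (hG : IsSprayOn (slit E M) G)
    {u₀ : TM E M} {z : E × E} (hz : z ∈ slitDom u₀)
    {V : (u : TM E M) → TTM u} (hV : SmoothFieldAt V (pt u₀ z)) :
    rep u₀ (hor G V) z = ((rep u₀ V z).1,
      (1 / 2 : ℝ) • fderiv ℝ (fun y => (rep u₀ G y).2) z (0, (rep u₀ V z).1)) := by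
  have h1 : rep u₀ (hor G V) z = (1 / 2 : ℝ) • (rep u₀ V z + rep u₀ (barthel G V) z) := by
    change coord u₀ (pt u₀ z) (_ • (_ + _)) = _
    rw [map_smul, map_add]
    rfl
  rw [h1, rep_barthel hG hz hV]
  refine Prod.ext ?_ ?_
  · simp only [Prod.smul_fst, Prod.fst_add]
    rw [← two_smul ℝ, smul_smul]; norm_num
  · simp only [Prod.smul_snd, Prod.snd_add, add_sub_cancel]

theorem rep_ver {G : (u : TM E M) → TTM u} (hG : IsSprayOn (slit E M) G)
    {u₀ : TM E M} {z : E × E} (hz : z ∈ slitDom u₀)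
    {V : (u : TM E M) → TTM u} (hV : SmoothFieldAt V (pt u₀ z)) :
    rep u₀ (ver G V) z = (0, (rep u₀ V z).2 -
      (1 / 2 : ℝ) • fderiv ℝ (fun y => (rep u₀ G y).2) z (0, (rep u₀ V z).1)) := by
  have h1 : rep u₀ (ver G V) z = (1 / 2 : ℝ) • (rep u₀ V z - rep u₀ (barthel G V) z) := by
    change coord u₀ (pt u₀ z) (_ • (_ - _)) = _
    rw [map_smul, map_sub]
    rfl
  rw [h1, rep_barthel hG hz hV]
  refine Prod.ext ?_ ?_
  · simp
  · simp only [Prod.smul_snd, Prod.snd_sub]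
    rw [sub_sub_eq_add_sub, ← two_smul ℝ, smul_sub, smul_smul]; norm_num

end FinslerCharts

/-! ### The concurrence conditions in coordinates. -/

section Concurrent

variable {E : Type*} [NormedAddCommGroup E] [NormedSpace ℝ E]
  {M : Type*} [TopologicalSpace M] [ChartedSpace E M] [IsManifold 𝓘(ℝ, E) ∞ M]

theorem eventually_of_slitDom {u₀ : TM E M} {z : E × E} (hz : z ∈ slitDom u₀)
    {p : TM E M → Prop} (hp : ∀ y ∈ slitDom u₀, p (pt u₀ y)) : ∀ᶠ v in 𝓝 (pt u₀ z), p v := by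
  have h1 : (bchart u₀) ⁻¹' (slitDom u₀) ∈ 𝓝 (pt u₀ z) := by
    refine (contMDiffAt_bchart (pt_mem_source hz.1)).continuousAt ?_
    rw [bchart_pt hz.1]
    exact (isOpen_slitDom u₀).mem_nhds hz
  filter_upwards [h1, (isOpen_extChartAt_source (I := 𝓘(ℝ, E).tangent) u₀).mem_nhds
    (pt_mem_source hz.1)] with v hv hv'
  rw [← pt_bchart hv']
  exact hp _ hv

theorem IsConcurrent.contDiffAt {F : TM E M → ℝ} {G : (u : TM E M) → TTM u}
    {φ : (u : TM E M) → Pull u} (hφ : IsConcurrent F G φ) {u₀ : TM E M} {z : E × E}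
    (hz : z ∈ slitDom u₀) : ContDiffAt ℝ ∞ (prep u₀ φ) z :=
  contDiffAt_prep hz.1 (hφ.smooth _ (pt_mem_slit hz))

theorem IsFinsler.metric_zero_left {F : TM E M → ℝ} (hF : IsFinsler F) {u : TM E M}
    (hu : u ∈ slit E M) (b : Pull u) : metric F u 0 b = 0 := by
  rw [hF.metric_eq (mem_bchart_source u) hu]
  have h : ((0, kap u u 0) : E × E) = 0 := by rw [map_zero]; rfl
  rw [h, map_zero]
  rfl

variable {F : TM E M → ℝ} {G : (u : TM E M) → TTM u}
  {φ : (u : TM E M) → Pull u}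

/-- The field with components `(c, 0)` in the bundle chart at `u₀`. -/
def constField (u₀ : TM E M) (c : E) : (u : TM E M) → TTM u := chartField u₀ fun _ => (c, 0)

/-- The lift of `φ` with components `(φ, 0)` in the bundle chart at `u₀`. -/
def liftField (u₀ : TM E M) (φ : (u : TM E M) → Pull u) : (u : TM E M) → TTM u :=
  chartField u₀ fun y => (prep u₀ φ y, 0)

theorem rep_fieldJ_constField {u₀ : TM E M} (c : E) {z : E × E} (hz : z ∈ slitDom u₀) :
    rep u₀ (fieldJ (constField u₀ c)) z = (0, c) := by
  rw [rep_fieldJ hz.1, constField, rep_chartField hz.1]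

theorem rep_fieldJ_liftField {u₀ : TM E M} {z : E × E} (hz : z ∈ slitDom u₀) :
    rep u₀ (fieldJ (liftField u₀ φ)) z = (0, prep u₀ φ z) := by
  rw [rep_fieldJ hz.1, liftField, rep_chartField hz.1]

theorem eventually_rho_liftField {u₀ : TM E M} {z : E × E} (hz : z ∈ slitDom u₀) :
    ∀ᶠ v in 𝓝 (pt u₀ z), rho v (liftField u₀ φ v) = φ v := by
  refine eventually_of_slitDom hz fun y hy => ?_
  apply kap_injective (pt_proj_mem hy.1)
  rw [← rep_fst hy.1, liftField, rep_chartField hy.1]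
  rfl

theorem IsFinsler.dFun_metricFun (hF : IsFinsler F) {u₀ : TM E M} {z : E × E}
    (hz : z ∈ slitDom u₀) {X Y : (u : TM E M) → TTM u} {x y : E × E → E}
    (hX : ∀ w ∈ slitDom u₀, (rep u₀ X w).1 = x w) (hY : ∀ w ∈ slitDom u₀, (rep u₀ Y w).1 = y w)
    (hx : ContDiffAt ℝ ∞ x z) (hy : ContDiffAt ℝ ∞ y z) (a : TTM (pt u₀ z)) :
    dFun (metricFun F X Y) (pt u₀ z) a =
      fderiv ℝ (fun w => fderiv ℝ (fderiv ℝ (frep u₀ (energy F))) w (0, x w) (0, y w)) z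
        (coord u₀ (pt u₀ z) a) := by
  have h1 : frep u₀ (metricFun F X Y) =ᶠ[𝓝 z]
      fun w => fderiv ℝ (fderiv ℝ (frep u₀ (energy F))) w (0, x w) (0, y w) := by
    filter_upwards [(isOpen_slitDom u₀).mem_nhds hz] with w hw
    rw [frep, hF.metricFun_pt hw, hX w hw, hY w hw]
  have h2 : ContDiffAt ℝ ∞ (frep u₀ (metricFun F X Y)) z := by
    refine ContDiffAt.congr_of_eventuallyEq ?_ h1
    exact ((hF.contDiffAt_energy hz).fderiv_infty.fderiv_infty.clm_apply
      (contDiffAt_const.prodMk hx)).clm_apply (contDiffAt_const.prodMk hy)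
  rw [dFun_pt hz.1 ((contMDiffAt_of_frep hz.1 h2).mdifferentiableAt (by simp)), h1.fderiv_eq]

variable [CompleteSpace E]

theorem IsSprayOn.contDiffAt {D : Set (TM E M)} (hG : IsSprayOn D G) {u₀ : TM E M} {z : E × E}
    (hz : z ∈ (bchart u₀).target) (hD : pt u₀ z ∈ D) :
    ContDiffAt ℝ ∞ (fun y => (rep u₀ G y).2) z :=
  (contDiffAt_rep hz (hG.smooth _ hD)).snd

theorem smoothFieldAt_hor (hG : IsSprayOn (slit E M) G) {u₀ : TM E M}
    {V : (u : TM E M) → TTM u} (hV : ∀ y ∈ slitDom u₀, SmoothFieldAt V (pt u₀ y))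
    {z : E × E} (hz : z ∈ slitDom u₀) : SmoothFieldAt (hor G V) (pt u₀ z) := by
  refine smoothFieldAt_of_contDiffAt_rep hz.1 ?_
  have h1 : ContDiffAt ℝ ∞ (fun y => ((rep u₀ V y).1,
      (1 / 2 : ℝ) • fderiv ℝ (fun y => (rep u₀ G y).2) y (0, (rep u₀ V y).1))) z := by
    have hV1 := (contDiffAt_rep hz.1 (hV z hz)).fst
    refine hV1.prodMk (contDiffAt_const.smul ?_)
    exact (hG.contDiffAt hz.1 (pt_mem_slit hz)).fderiv_infty.clm_apply (contDiffAt_const.prodMk hV1)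
  refine h1.congr_of_eventuallyEq ?_
  filter_upwards [(isOpen_slitDom u₀).mem_nhds hz] with y hy using rep_hor hG hy (hV y hy)

theorem smoothFieldAt_constField (u₀ : TM E M) (c : E) :
    ∀ y ∈ slitDom u₀, SmoothFieldAt (constField u₀ c) (pt u₀ y) :=
  fun _ hy => smoothFieldAt_chartField hy.1 contDiffAt_const

theorem IsConcurrent.smoothFieldAt_liftField (hφ : IsConcurrent F G φ) (u₀ : TM E M) :
    ∀ y ∈ slitDom u₀, SmoothFieldAt (liftField u₀ φ) (pt u₀ y) :=
  fun _ hy => smoothFieldAt_chartField hy.1 ((hφ.contDiffAt hy).prodMk contDiffAt_const)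

theorem rep_hor_constField (hG : IsSprayOn (slit E M) G) {u₀ : TM E M} (c : E) {z : E × E}
    (hz : z ∈ slitDom u₀) :
    rep u₀ (hor G (constField u₀ c)) z =
      (c, (1 / 2 : ℝ) • fderiv ℝ (fun y => (rep u₀ G y).2) z (0, c)) := by
  rw [rep_hor hG hz (smoothFieldAt_constField u₀ c z hz), constField, rep_chartField hz.1]

theorem IsConcurrent.rep_hor_liftField (hG : IsSprayOn (slit E M) G) (hφ : IsConcurrent F G φ)
    {u₀ : TM E M} {z : E × E} (hz : z ∈ slitDom u₀) :
    rep u₀ (hor G (liftField u₀ φ)) z =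
      (prep u₀ φ z, (1 / 2 : ℝ) • fderiv ℝ (fun y => (rep u₀ G y).2) z (0, prep u₀ φ z)) := by
  rw [rep_hor hG hz (hφ.smoothFieldAt_liftField u₀ z hz), liftField, rep_chartField hz.1]

theorem rep_bracket_fst {u₀ : TM E M} {z : E × E} (hz : z ∈ slitDom u₀)
    {V W : (u : TM E M) → TTM u} (hV : SmoothFieldAt V (pt u₀ z))
    (hW : SmoothFieldAt W (pt u₀ z)) {v w : E × E → E}
    (hv : ∀ y ∈ slitDom u₀, (rep u₀ V y).1 = v y) (hw : ∀ y ∈ slitDom u₀, (rep u₀ W y).1 = w y) :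
    (rep u₀ (bracket V W) z).1 =
      fderiv ℝ w z (rep u₀ V z) - fderiv ℝ v z (rep u₀ W z) := by
  have hdV := (contDiffAt_rep hz.1 hV).differentiableAt (by simp)
  have hdW := (contDiffAt_rep hz.1 hW).differentiableAt (by simp)
  have ev : (fun y => (rep u₀ V y).1) =ᶠ[𝓝 z] v := by
    filter_upwards [(isOpen_slitDom u₀).mem_nhds hz] with y hy using hv y hy
  have ew : (fun y => (rep u₀ W y).1) =ᶠ[𝓝 z] w := by
    filter_upwards [(isOpen_slitDom u₀).mem_nhds hz] with y hy using hw y hy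
  rw [rep_bracket hz.1 hV hW, lieBracket,
    fderiv_pair hdV.fst hdV.snd (Eventually.of_forall fun y => rfl),
    fderiv_pair hdW.fst hdW.snd (Eventually.of_forall fun y => rfl), ev.fderiv_eq, ew.fderiv_eq]
  rfl

theorem rho_bracket_constField_liftField (hG : IsSprayOn (slit E M) G)
    (hφ : IsConcurrent F G φ) {u₀ : TM E M} (c : E) {z : E × E} (hz : z ∈ slitDom u₀) :
    (rep u₀ (bracket (fieldJ (constField u₀ c)) (hor G (liftField u₀ φ))) z).1 =
      fderiv ℝ (prep u₀ φ) z (0, c) := by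
  rw [rep_bracket_fst hz (smoothFieldAt_fieldJ hz.1 (smoothFieldAt_constField u₀ c z hz))
    (smoothFieldAt_hor hG (hφ.smoothFieldAt_liftField u₀) hz) (v := fun _ => 0)
    (fun y hy => by rw [rep_fieldJ_constField c hy])
    (fun y hy => by rw [hφ.rep_hor_liftField hG hy]), rep_fieldJ_constField c hz]
  simp

/-- A concurrent `π`-vector field does not depend on the directional argument. -/
theorem IsConcurrent.fderiv_vertical (hG : IsSprayOn (slit E M) G) (hφ : IsConcurrent F G φ)
    {u₀ : TM E M} {z : E × E} (hz : z ∈ slitDom u₀) (c : E) :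
    fderiv ℝ (prep u₀ φ) z (0, c) = 0 := by
  -- For a constant field and the lift `(φ, 0)`, the base component of `[JX, hY]` is the vertical
  -- derivative of `φ`.
  have h := (hφ.deriv_eq _ (pt_mem_slit hz) _ _ (smoothFieldAt_constField u₀ c z hz)
    (hφ.smoothFieldAt_liftField u₀ z hz) (eventually_rho_liftField hz)).2.2.2
  rw [← rho_bracket_constField_liftField hG hφ c hz, rep_fst hz.1]
  rw [HasBerwaldDerivVer] at h
  rw [← h, map_zero]

/-- The horizontal Berwald condition. The second derivative of the fibre part of `G` plays the role
of the Berwald connection coefficients. -/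
theorem IsConcurrent.fderiv_horizontal (hG : IsSprayOn (slit E M) G) (hφ : IsConcurrent F G φ)
    {u₀ : TM E M} {z : E × E} (hz : z ∈ slitDom u₀) (c : E) :
    fderiv ℝ (prep u₀ φ) z (c, 0) - (1 / 2 : ℝ) •
      fderiv ℝ (fderiv ℝ (fun y => (rep u₀ G y).2)) z (0, prep u₀ φ z) (0, c) = -c := by
  have h := (hφ.deriv_eq _ (pt_mem_slit hz) _ _ (smoothFieldAt_constField u₀ c z hz)
    (hφ.smoothFieldAt_liftField u₀ z hz) (eventually_rho_liftField hz)).2.1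
  have hX : ∀ y ∈ slitDom u₀, SmoothFieldAt (hor G (constField u₀ c)) (pt u₀ y) :=
    fun y hy => smoothFieldAt_hor hG (smoothFieldAt_constField u₀ c) hy
  have hY : ∀ y ∈ slitDom u₀, SmoothFieldAt (fieldJ (liftField u₀ φ)) (pt u₀ y) :=
    fun y hy => smoothFieldAt_fieldJ hy.1 (hφ.smoothFieldAt_liftField u₀ y hy)
  -- The vertical projection is itself defined by brackets, so its coordinate formula needs the
  -- bracket to be a smooth field.
  have hB : SmoothFieldAt (bracket (hor G (constField u₀ c)) (fieldJ (liftField u₀ φ)))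
      (pt u₀ z) := by
    refine smoothFieldAt_of_contDiffAt_rep hz.1 ?_
    have h1 : ContDiffAt ℝ ∞ (lieBracket ℝ (rep u₀ (hor G (constField u₀ c)))
        (rep u₀ (fieldJ (liftField u₀ φ)))) z :=
      ContDiffAt.lieBracket_vectorField (n := ∞) (contDiffAt_rep hz.1 (hX z hz))
        (contDiffAt_rep hz.1 (hY z hz)) (by simp)
    refine h1.congr_of_eventuallyEq ?_
    filter_upwards [(isOpen_slitDom u₀).mem_nhds hz] with y hy
      using rep_bracket hy.1 (hX y hy) (hY y hy)
  have hg := hG.contDiffAt hz.1 (pt_mem_slit hz)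
  have hf := (hφ.contDiffAt hz).differentiableAt (by simp)
  have hb : rep u₀ (bracket (hor G (constField u₀ c)) (fieldJ (liftField u₀ φ))) z =
      (0, fderiv ℝ (prep u₀ φ) z
          (c, (1 / 2 : ℝ) • fderiv ℝ (fun y => (rep u₀ G y).2) z (0, c)) -
        (1 / 2 : ℝ) •
          fderiv ℝ (fderiv ℝ (fun y => (rep u₀ G y).2)) z (0, prep u₀ φ z) (0, c)) := by
    have e1 : rep u₀ (hor G (constField u₀ c)) =ᶠ[𝓝 z] fun y => ((fun _ => c) y,
        (fun y => (1 / 2 : ℝ) • fderiv ℝ (fun y => (rep u₀ G y).2) y (0, c)) y) := by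
      filter_upwards [(isOpen_slitDom u₀).mem_nhds hz] with y hy using rep_hor_constField hG c hy
    have e2 : rep u₀ (fieldJ (liftField u₀ φ)) =ᶠ[𝓝 z] fun y => ((fun _ => 0) y, prep u₀ φ y) := by
      filter_upwards [(isOpen_slitDom u₀).mem_nhds hz] with y hy using rep_fieldJ_liftField hy
    have hd : DifferentiableAt ℝ (fun y => fderiv ℝ (fun y => (rep u₀ G y).2) y (0, c)) z :=
      hg.differentiableAt_fderiv.clm_apply (differentiableAt_const _)
    rw [rep_bracket hz.1 (hX z hz) (hY z hz), lieBracket,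
      fderiv_pair (differentiableAt_const c) (hd.const_smul (1 / 2 : ℝ)) e1,
      fderiv_pair (differentiableAt_const 0) hf e2, rep_hor_constField hG c hz,
      rep_fieldJ_liftField hz, fderiv_const_smul hd]
    refine Prod.ext ?_ ?_
    · simp
    · simp [fderiv_fderiv_const hg]
  have h2 : (0, kap u₀ (pt u₀ z) (- rho (pt u₀ z) (constField u₀ c (pt u₀ z)))) =
      rep u₀ (ver G (bracket (hor G (constField u₀ c)) (fieldJ (liftField u₀ φ)))) z := by
    rw [← coord_gam (pt_mem_source hz.1)]
    exact congrArg (coord u₀ (pt u₀ z)) h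
  rw [rep_ver hG hz hB, hb, map_neg, ← rep_fst hz.1, constField, rep_chartField hz.1] at h2
  have h3 := congrArg Prod.snd h2
  -- The vertical part of the horizontal lift does not act on `φ`, whose vertical derivative is
  -- zero.
  have h4 : ((c, (1 / 2 : ℝ) • fderiv ℝ (fun y => (rep u₀ G y).2) z (0, c)) : E × E) =
    (c, 0) + (0, (1 / 2 : ℝ) • fderiv ℝ (fun y => (rep u₀ G y).2) z (0, c)) := by simp
  rw [h4, map_add, hφ.fderiv_vertical hG hz, add_zero] at h3
  have h5 : ((0, 0) : E × E) = 0 := rfl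
  simp only [h5, map_zero, smul_zero, sub_zero] at h3
  exact h3.symm

/-- The Cartan tensor vanishes on a concurrent `π`-vector field. -/
theorem IsConcurrent.fderiv_metric_vertical (hF : IsFinsler F) (hG : IsSprayOn (slit E M) G)
    (hφ : IsConcurrent F G φ) {u₀ : TM E M} {z : E × E} (hz : z ∈ slitDom u₀) (c d : E) :
    fderiv ℝ (fun w => fderiv ℝ (fderiv ℝ (frep u₀ (energy F))) w (0, prep u₀ φ w) (0, d)) z
      (0, c) = 0 := by
  have h := (hφ.deriv_eq _ (pt_mem_slit hz) _ _ (smoothFieldAt_constField u₀ c z hz)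
    (hφ.smoothFieldAt_liftField u₀ z hz) (eventually_rho_liftField hz)).2.2.1
    (constField u₀ d) (smoothFieldAt_constField u₀ d z hz)
  -- Both bracket terms of the vertical Cartan formula vanish, here by constancy of components and
  -- in the other term by `IsConcurrent.fderiv_vertical`; only the derivative of `g(φ, d)` survives.
  have hb : (rep u₀ (bracket (hor G (constField u₀ d)) (fieldJ (constField u₀ c))) z).1 = 0 := by
    rw [rep_bracket_fst hz (smoothFieldAt_hor hG (smoothFieldAt_constField u₀ d) hz)
      (smoothFieldAt_fieldJ hz.1 (smoothFieldAt_constField u₀ c z hz))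
      (v := fun _ => d) (w := fun _ => 0)
      (fun y hy => by rw [rep_hor_constField hG d hy])
      (fun y hy => by rw [rep_fieldJ_constField c hy])]
    simp
  have h0 : ((0, 0) : E × E) = 0 := rfl
  rw [hF.metric_zero_left (pt_mem_slit hz), hF.metricFun_pt hz, hF.metricFun_pt hz,
    rho_bracket_constField_liftField hG hφ c hz, hφ.fderiv_vertical hG hz, hb,
    hF.dFun_metricFun hz (x := prep u₀ φ) (y := fun _ => d)
      (fun y hy => by rw [liftField, rep_chartField hy.1])
      (fun y hy => by rw [constField, rep_chartField hy.1]) (hφ.contDiffAt hz) contDiffAt_const]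
    at h
  change _ = fderiv ℝ _ z (rep u₀ (fieldJ (constField u₀ c)) z) + _ + _ at h
  rw [rep_fieldJ_constField c hz, h0, map_zero, map_zero] at h
  simpa using h.symm

/-- The horizontal Cartan condition, rearranged so that the left side is antisymmetric and the right
side symmetric in `c` and `d`. The terms on the right need not be evaluated. -/
theorem IsConcurrent.fderiv_metric_horizontal_sub (hF : IsFinsler F)
    (hG : IsSprayOn (slit E M) G) (hφ : IsConcurrent F G φ) {u₀ : TM E M} {z : E × E}
    (hz : z ∈ slitDom u₀) (c d : E) :
    fderiv ℝ (fun w => fderiv ℝ (fderiv ℝ (frep u₀ (energy F))) w (0, prep u₀ φ w) (0, d)) z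
      (c, 0) -
    fderiv ℝ (fun w => fderiv ℝ (fderiv ℝ (frep u₀ (energy F))) w (0, prep u₀ φ w) (0, c)) z
      (d, 0) =
    - 2 * fderiv ℝ (fderiv ℝ (frep u₀ (energy F))) z (0, c) (0, d)
    - fderiv ℝ (fun w => fderiv ℝ (fderiv ℝ (frep u₀ (energy F))) w (0, d) (0, c)) z
        (rep u₀ (hor G (liftField u₀ φ)) z)
    - fderiv ℝ (fderiv ℝ (frep u₀ (energy F))) z (0, c) (0, fderiv ℝ (prep u₀ φ) z (d, 0))
    - fderiv ℝ (fderiv ℝ (frep u₀ (energy F))) z (0, d) (0, fderiv ℝ (prep u₀ φ) z (c, 0)) := by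
  have h := (hφ.deriv_eq _ (pt_mem_slit hz) _ _ (smoothFieldAt_constField u₀ c z hz)
    (hφ.smoothFieldAt_liftField u₀ z hz) (eventually_rho_liftField hz)).1
    (constField u₀ d) (smoothFieldAt_constField u₀ d z hz)
  have hc : ∀ c, ∀ y ∈ slitDom u₀, (rep u₀ (constField u₀ c) y).1 = c :=
    fun c y hy => by rw [constField, rep_chartField hy.1]
  have hl : ∀ y ∈ slitDom u₀, (rep u₀ (liftField u₀ φ) y).1 = prep u₀ φ y :=
    fun y hy => by rw [liftField, rep_chartField hy.1]
  have hhc : ∀ c, ∀ y ∈ slitDom u₀, (rep u₀ (hor G (constField u₀ c)) y).1 = c :=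
    fun c y hy => by rw [rep_hor_constField hG c hy]
  have hhl : ∀ y ∈ slitDom u₀, (rep u₀ (hor G (liftField u₀ φ)) y).1 = prep u₀ φ y :=
    fun y hy => by rw [hφ.rep_hor_liftField hG hy]
  have hsc := fun c => smoothFieldAt_hor hG (smoothFieldAt_constField u₀ c) hz
  have hsl := smoothFieldAt_hor hG (hφ.smoothFieldAt_liftField u₀) hz
  have hsplit : ∀ (c : E) (n : E), ((c, n) : E × E) = (c, 0) + (0, n) := by simp
  have b1 : ∀ c, (rep u₀ (bracket (hor G (constField u₀ c)) (hor G (liftField u₀ φ))) z).1 =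
      fderiv ℝ (prep u₀ φ) z (c, 0) := by
    intro c
    rw [rep_bracket_fst hz (hsc c) hsl (v := fun _ => c) (w := prep u₀ φ) (hhc c) hhl,
      rep_hor_constField hG c hz, hsplit, map_add, hφ.fderiv_vertical hG hz]
    simp
  have b2 : ∀ c, (rep u₀ (bracket (hor G (liftField u₀ φ)) (hor G (constField u₀ c))) z).1 =
      - fderiv ℝ (prep u₀ φ) z (c, 0) := by
    intro c
    rw [rep_bracket_fst hz hsl (hsc c) (w := fun _ => c) (v := prep u₀ φ) hhl (hhc c),
      rep_hor_constField hG c hz, hsplit, map_add, hφ.fderiv_vertical hG hz]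
    simp
  have b3 : (rep u₀ (bracket (hor G (constField u₀ d)) (hor G (constField u₀ c))) z).1 = 0 := by
    rw [rep_bracket_fst hz (hsc d) (hsc c) (w := fun _ => c) (v := fun _ => d) (hhc d) (hhc c)]
    simp
  rw [hF.metric_pt hz, map_neg, ← rep_fst hz.1, ← rep_fst hz.1,
    hF.metricFun_pt hz, hF.metricFun_pt hz, hF.metricFun_pt hz, b1, b2, b3,
    hc c z hz, hc d z hz, hl z hz,
    hF.dFun_metricFun hz hl (y := fun _ => d) (hc d) (hφ.contDiffAt hz) contDiffAt_const,
    hF.dFun_metricFun hz (x := fun _ => d) (y := fun _ => c) (hc d) (hc c) contDiffAt_const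
      contDiffAt_const,
    hF.dFun_metricFun hz (x := fun _ => c) (hc c) hl contDiffAt_const (hφ.contDiffAt hz)] at h
  have hsymm : (fun w => fderiv ℝ (fderiv ℝ (frep u₀ (energy F))) w (0, c) (0, prep u₀ φ w))
      =ᶠ[𝓝 z]
      fun w => fderiv ℝ (fderiv ℝ (frep u₀ (energy F))) w (0, prep u₀ φ w) (0, c) := by
    filter_upwards [(isOpen_slitDom u₀).mem_nhds hz] with w hw
      using fderiv_fderiv_symm (hF.contDiffAt_energy hw) _ _
  have hr : ∀ V : (u : TM E M) → TTM u, coord u₀ (pt u₀ z) (V (pt u₀ z)) = rep u₀ V z :=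
    fun V => rfl
  -- Vertical derivatives of `g(φ, ·)` vanish, so its derivatives along horizontal lifts of `c` and
  -- `d` become plain base derivatives.
  rw [hr, hr, hr, rep_hor_constField hG c hz, rep_hor_constField hG d hz, hsymm.fderiv_eq,
    hsplit c, hsplit d ((1 / 2 : ℝ) • _), map_add, map_add,
    hφ.fderiv_metric_vertical hF hG hz, hφ.fderiv_metric_vertical hF hG hz] at h
  have hneg : ∀ x : E, ((0, -x) : E × E) = -(0, x) := by simp
  have h0 : ((0, 0) : E × E) = 0 := rfl
  simp only [hneg, h0, map_neg, map_zero, neg_apply] at h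
  linarith

/-- An expression both symmetric and antisymmetric in `c`, `d` is zero. -/
theorem IsConcurrent.fderiv_metric_horizontal (hF : IsFinsler F) (hG : IsSprayOn (slit E M) G)
    (hφ : IsConcurrent F G φ) {u₀ : TM E M} {z : E × E} (hz : z ∈ slitDom u₀) (c d : E) :
    fderiv ℝ (fun w => fderiv ℝ (fderiv ℝ (frep u₀ (energy F))) w (0, prep u₀ φ w) (0, d)) z
      (c, 0) =
    fderiv ℝ (fun w => fderiv ℝ (fderiv ℝ (frep u₀ (energy F))) w (0, prep u₀ φ w) (0, c)) z
      (d, 0) := by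
  have h1 := hφ.fderiv_metric_horizontal_sub hF hG hz c d
  have h2 := hφ.fderiv_metric_horizontal_sub hF hG hz d c
  have hsymm : (fun w => fderiv ℝ (fderiv ℝ (frep u₀ (energy F))) w (0, c) (0, d))
      =ᶠ[𝓝 z] fun w => fderiv ℝ (fderiv ℝ (frep u₀ (energy F))) w (0, d) (0, c) := by
    filter_upwards [(isOpen_slitDom u₀).mem_nhds hz] with w hw
      using fderiv_fderiv_symm (hF.contDiffAt_energy hw) _ _
  rw [hsymm.fderiv_eq, fderiv_fderiv_symm (hF.contDiffAt_energy hz) (0, d) (0, c)] at h2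
  linarith

end Concurrent

/-! ### The functions `Φ` and `p²`, and their derivatives along the spray. -/

section BigPhi

variable {E : Type*} [NormedAddCommGroup E] [NormedSpace ℝ E]
  {M : Type*} [TopologicalSpace M] [ChartedSpace E M] [IsManifold 𝓘(ℝ, E) ∞ M]
  {F : TM E M → ℝ} {G : (u : TM E M) → TTM u} {φ : (u : TM E M) → Pull u}

/-- Euler's relation for the energy, differentiated once in an arbitrary direction. -/
theorem IsFinsler.fderiv_fderiv_radial (hF : IsFinsler F) {u₀ : TM E M} {z : E × E}
    (hz : z ∈ slitDom u₀) (a : E × E) :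
    fderiv ℝ (fderiv ℝ (frep u₀ (energy F))) z a (0, z.2) =
      2 * fderiv ℝ (frep u₀ (energy F)) z a - fderiv ℝ (frep u₀ (energy F)) z (0, a.2) := by
  have he := hF.contDiffAt_energy hz
  have hev : (fun y : E × E => fderiv ℝ (frep u₀ (energy F)) y (0, y.2)) =ᶠ[𝓝 z]
      fun y => 2 * frep u₀ (energy F) y := by
    filter_upwards [(isOpen_slitDom u₀).mem_nhds hz] with y hy using hF.fderiv_energy_radial hy
  have hd : DifferentiableAt ℝ (fun y : E × E => ((0, y.2) : E × E)) z := by fun_prop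
  have h1 := fderiv_fderiv_apply he hd a
  rw [hev.fderiv_eq, fderiv_const_mul (he.differentiableAt (by simp)),
    fderiv_pair (differentiableAt_const 0) differentiableAt_snd EventuallyEq.rfl] at h1
  simp [fderiv_snd] at h1
  linarith

theorem IsFinsler.frep_bigPhi (hF : IsFinsler F) {u₀ : TM E M} {z : E × E}
    (hz : z ∈ slitDom u₀) :
    frep u₀ (bigPhi F φ) z = fderiv ℝ (frep u₀ (energy F)) z (0, prep u₀ φ z) := by
  have h : frep u₀ (bigPhi F φ) z = fderiv ℝ (fderiv ℝ (frep u₀ (energy F))) z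
      (0, prep u₀ φ z) (0, prep u₀ eta z) := hF.metric_pt hz _ _
  rw [h, prep_eta hz.1, hF.fderiv_fderiv_radial hz]
  ring

theorem IsFinsler.frep_bigPhi_eventuallyEq (hF : IsFinsler F) {u₀ : TM E M} {z : E × E}
    (hz : z ∈ slitDom u₀) :
    frep u₀ (bigPhi F φ) =ᶠ[𝓝 z]
      fun y => fderiv ℝ (frep u₀ (energy F)) y (0, prep u₀ φ y) := by
  filter_upwards [(isOpen_slitDom u₀).mem_nhds hz] with y hy using hF.frep_bigPhi hy

theorem IsConcurrent.contDiffAt_bigPhi (hF : IsFinsler F) (hφ : IsConcurrent F G φ)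
    {u₀ : TM E M} {z : E × E} (hz : z ∈ slitDom u₀) :
    ContDiffAt ℝ ∞ (frep u₀ (bigPhi F φ)) z := by
  refine ContDiffAt.congr_of_eventuallyEq ?_ (hF.frep_bigPhi_eventuallyEq hz)
  exact (hF.contDiffAt_energy hz).fderiv_infty.clm_apply
    (contDiffAt_const.prodMk (hφ.contDiffAt hz))

theorem IsConcurrent.fderiv_bigPhi (hF : IsFinsler F) (hφ : IsConcurrent F G φ)
    {u₀ : TM E M} {z : E × E} (hz : z ∈ slitDom u₀) (a : E × E) :
    fderiv ℝ (frep u₀ (bigPhi F φ)) z a =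
      fderiv ℝ (fderiv ℝ (frep u₀ (energy F))) z a (0, prep u₀ φ z)
        + fderiv ℝ (frep u₀ (energy F)) z (0, fderiv ℝ (prep u₀ φ) z a) := by
  have hf := (hφ.contDiffAt hz).differentiableAt (by simp)
  rw [(hF.frep_bigPhi_eventuallyEq hz).fderiv_eq,
    fderiv_fderiv_apply (hF.contDiffAt_energy hz) ((differentiableAt_const 0).prodMk hf),
    fderiv_pair (differentiableAt_const 0) hf EventuallyEq.rfl]
  simp

/-- Evaluate the geodesic equation on `G` itself: the Hilbert form is alternating, so the energy is
constant along the spray. -/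
theorem IsGeodesicSprayOn.fderiv_energy (hF : IsFinsler F)
    (hG : IsGeodesicSprayOn (slit E M) F G) {u₀ : TM E M} {z : E × E} (hz : z ∈ slitDom u₀) :
    fderiv ℝ (frep u₀ (energy F)) z (rep u₀ G z) = 0 := by
  have h := hG.hilbert_eq _ (pt_mem_slit hz) (G (pt u₀ z))
  rw [hilbertForm_self, dFun_pt hz.1
    ((contMDiffAt_energy (hF.smooth _ (pt_mem_slit hz))).mdifferentiableAt (by simp))] at h
  exact (neg_eq_zero.1 h.symm)

theorem IsFinsler.hilbertForm_chart (hF : IsFinsler F) {u₀ : TM E M} (hu : u₀ ∈ slit E M)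
    (a b : TTM u₀) :
    hilbertForm F u₀ a b =
      fderiv ℝ (fderiv ℝ (frep u₀ (energy F))) (bchart u₀ u₀) (coord u₀ u₀ a)
        (0, (coord u₀ u₀ b).1)
      - fderiv ℝ (fderiv ℝ (frep u₀ (energy F))) (bchart u₀ u₀) (coord u₀ u₀ b)
          (0, (coord u₀ u₀ a).1) :=
  hilbertForm_eq (by filter_upwards [isOpen_slit.mem_nhds hu] with v hv using hF.smooth v hv) a b

theorem rep_bchart_self (u₀ : TM E M) (V : (u : TM E M) → TTM u) :
    rep u₀ V (bchart u₀ u₀) = coord u₀ u₀ (V u₀) := by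
  have h : ∀ v, v = u₀ → (coord u₀ v (V v) : E × E) = coord u₀ u₀ (V u₀) := by
    rintro v rfl; rfl
  exact h _ (pt_bchart_self u₀)

theorem dFun_self {f : TM E M → ℝ} {u₀ : TM E M}
    (hf : MDifferentiableAt 𝓘(ℝ, E).tangent 𝓘(ℝ, ℝ) f u₀) (a : TTM u₀) :
    dFun f u₀ a = fderiv ℝ (frep u₀ f) (bchart u₀ u₀) (coord u₀ u₀ a) := by
  have h : ∀ v, v = u₀ → ∀ a : E × E, dFun f v a = dFun f u₀ a ∧
      (coord u₀ v a : E × E) = coord u₀ u₀ a := by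
    rintro v rfl a; exact ⟨rfl, rfl⟩
  have h1 := h _ (pt_bchart_self u₀) a
  have h2 := dFun_pt (u₀ := u₀) (z := bchart u₀ u₀)
    ((bchart u₀).map_source (mem_bchart_source u₀)) (f := f)
    (by rw [pt_bchart_self]; exact hf) (show E × E from a)
  refine h1.1.symm.trans (h2.trans ?_)
  exact congrArg (fderiv ℝ (frep u₀ f) (bchart u₀ u₀)) h1.2

/-- The geodesic equation in the bundle chart. -/
theorem IsGeodesicSprayOn.chart_eq (hF : IsFinsler F)
    (hG : IsGeodesicSprayOn (slit E M) F G) {u₀ : TM E M} (hu : u₀ ∈ slit E M) (b : E × E) :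
    fderiv ℝ (fderiv ℝ (frep u₀ (energy F))) (bchart u₀ u₀) (rep u₀ G (bchart u₀ u₀)) (0, b.1)
      - fderiv ℝ (fderiv ℝ (frep u₀ (energy F))) (bchart u₀ u₀) b (0, (bchart u₀ u₀).2) =
    - fderiv ℝ (frep u₀ (energy F)) (bchart u₀ u₀) b := by
  have hz := bchart_self_mem_slitDom hu
  have h := hG.hilbert_eq u₀ hu (show TTM u₀ from b)
  have hG1 : (rep u₀ G (bchart u₀ u₀)).1 = (bchart u₀ u₀).2 :=
    hG.isSpray.rep_fst hz.1 (pt_mem_slit hz)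
  rw [hF.hilbertForm_chart hu, dFun_self
    ((contMDiffAt_energy (hF.smooth u₀ hu)).mdifferentiableAt (by simp)), coord_self u₀ b,
    ← rep_bchart_self, hG1] at h
  exact h

variable [CompleteSpace E]

theorem IsConcurrent.fderiv_bigPhi_vertical (hF : IsFinsler F) (hG : IsSprayOn (slit E M) G)
    (hφ : IsConcurrent F G φ) {u₀ : TM E M} {z : E × E} (hz : z ∈ slitDom u₀) (c : E) :
    fderiv ℝ (frep u₀ (bigPhi F φ)) z (0, c) =
      fderiv ℝ (fderiv ℝ (frep u₀ (energy F))) z (0, prep u₀ φ z) (0, c) := by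
  rw [hφ.fderiv_bigPhi hF hz, hφ.fderiv_vertical hG hz,
    fderiv_fderiv_symm (hF.contDiffAt_energy hz)]
  have h0 : ((0, 0) : E × E) = 0 := rfl
  rw [h0, map_zero, add_zero]

theorem IsConcurrent.fderiv_bigPhi_radial (hF : IsFinsler F) (hG : IsSprayOn (slit E M) G)
    (hφ : IsConcurrent F G φ) {u₀ : TM E M} {z : E × E} (hz : z ∈ slitDom u₀) :
    fderiv ℝ (frep u₀ (bigPhi F φ)) z (0, z.2) = frep u₀ (bigPhi F φ) z := by
  rw [hφ.fderiv_bigPhi_vertical hF hG hz, hF.fderiv_fderiv_radial hz, hF.frep_bigPhi hz]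
  ring

/-- The vertical derivatives of `Φ` are the components of `g(φ, ·)`, which do not depend on `y`;
only the base part of `a` contributes. -/
theorem IsConcurrent.fderiv_fderiv_bigPhi (hF : IsFinsler F) (hG : IsSprayOn (slit E M) G)
    (hφ : IsConcurrent F G φ) {u₀ : TM E M} {z : E × E} (hz : z ∈ slitDom u₀) (a : E × E) (c : E) :
    fderiv ℝ (fderiv ℝ (frep u₀ (bigPhi F φ))) z a (0, c) =
      fderiv ℝ (fun w => fderiv ℝ (fderiv ℝ (frep u₀ (energy F))) w (0, prep u₀ φ w) (0, c)) z
        (a.1, 0) := by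
  have hev : (fun y => fderiv ℝ (frep u₀ (bigPhi F φ)) y (0, c)) =ᶠ[𝓝 z]
      fun w => fderiv ℝ (fderiv ℝ (frep u₀ (energy F))) w (0, prep u₀ φ w) (0, c) := by
    filter_upwards [(isOpen_slitDom u₀).mem_nhds hz] with y hy
      using hφ.fderiv_bigPhi_vertical hF hG hy c
  rw [← fderiv_fderiv_const (hφ.contDiffAt_bigPhi hF hz), hev.fderiv_eq]
  have ha : a = (a.1, 0) + (0, a.2) := by simp
  conv_lhs => rw [ha]
  rw [map_add, hφ.fderiv_metric_vertical hF hG hz, add_zero]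

/-- The 1-form `d_J Φ` is closed. -/
theorem IsConcurrent.fderiv_fderiv_bigPhi_symm (hF : IsFinsler F) (hG : IsSprayOn (slit E M) G)
    (hφ : IsConcurrent F G φ) {u₀ : TM E M} {z : E × E} (hz : z ∈ slitDom u₀) (a b : E × E) :
    fderiv ℝ (fderiv ℝ (frep u₀ (bigPhi F φ))) z a (0, b.1) =
      fderiv ℝ (fderiv ℝ (frep u₀ (bigPhi F φ))) z b (0, a.1) := by
  rw [hφ.fderiv_fderiv_bigPhi hF hG hz, hφ.fderiv_fderiv_bigPhi hF hG hz,
    hφ.fderiv_metric_horizontal hF hG hz]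

theorem IsConcurrent.frep_pSq (hF : IsFinsler F) (hG : IsSprayOn (slit E M) G)
    (hφ : IsConcurrent F G φ) {u₀ : TM E M} {z : E × E} (hz : z ∈ slitDom u₀) :
    frep u₀ (pSq F φ) z = fderiv ℝ (frep u₀ (bigPhi F φ)) z (0, prep u₀ φ z) := by
  rw [hφ.fderiv_bigPhi_vertical hF hG hz]
  exact hF.metric_pt hz _ _

theorem IsConcurrent.frep_pSq_eventuallyEq (hF : IsFinsler F) (hG : IsSprayOn (slit E M) G)
    (hφ : IsConcurrent F G φ) {u₀ : TM E M} {z : E × E} (hz : z ∈ slitDom u₀) :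
    frep u₀ (pSq F φ) =ᶠ[𝓝 z]
      fun y => fderiv ℝ (frep u₀ (bigPhi F φ)) y (0, prep u₀ φ y) := by
  filter_upwards [(isOpen_slitDom u₀).mem_nhds hz] with y hy using hφ.frep_pSq hF hG hy

theorem IsConcurrent.contDiffAt_pSq (hF : IsFinsler F) (hG : IsSprayOn (slit E M) G)
    (hφ : IsConcurrent F G φ) {u₀ : TM E M} {z : E × E} (hz : z ∈ slitDom u₀) :
    ContDiffAt ℝ ∞ (frep u₀ (pSq F φ)) z := by
  refine ContDiffAt.congr_of_eventuallyEq ?_ (hφ.frep_pSq_eventuallyEq hF hG hz)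
  exact (hφ.contDiffAt_bigPhi hF hz).fderiv_infty.clm_apply
    (contDiffAt_const.prodMk (hφ.contDiffAt hz))

theorem IsConcurrent.fderiv_pSq_vertical (hF : IsFinsler F) (hG : IsSprayOn (slit E M) G)
    (hφ : IsConcurrent F G φ) {u₀ : TM E M} {z : E × E} (hz : z ∈ slitDom u₀) (c : E) :
    fderiv ℝ (frep u₀ (pSq F φ)) z (0, c) = 0 := by
  have hf := (hφ.contDiffAt hz).differentiableAt (by simp)
  have h0 : ((0, 0) : E × E) = 0 := rfl
  rw [(hφ.frep_pSq_eventuallyEq hF hG hz).fderiv_eq,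
    fderiv_fderiv_apply (hφ.contDiffAt_bigPhi hF hz) ((differentiableAt_const 0).prodMk hf),
    fderiv_pair (differentiableAt_const 0) hf EventuallyEq.rfl, hφ.fderiv_vertical hG hz,
    hφ.fderiv_fderiv_bigPhi hF hG hz]
  simp [h0]

/-- The Barthel connection is conservative. -/
theorem IsGeodesicSprayOn.fderiv_energy_horizontal (hF : IsFinsler F)
    (hG : IsGeodesicSprayOn (slit E M) F G) {u₀ : TM E M} (hu : u₀ ∈ slit E M) (c : E) :
    fderiv ℝ (frep u₀ (energy F)) (bchart u₀ u₀) (c, (1 / 2 : ℝ) •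
      fderiv ℝ (fun y => (rep u₀ G y).2) (bchart u₀ u₀) (0, c)) = 0 := by
  have hz := bchart_self_mem_slitDom hu
  set z := bchart u₀ u₀ with hzdef
  have he := hF.contDiffAt_energy hz
  have hg := (hG.isSpray.contDiffAt hz.1 (pt_mem_slit hz)).differentiableAt (by simp)
  have hGd : DifferentiableAt ℝ (rep u₀ G) z :=
    (contDiffAt_rep hz.1 (hG.isSpray.smooth _ (pt_mem_slit hz))).differentiableAt (by simp)
  have hev : (fun y => fderiv ℝ (frep u₀ (energy F)) y (rep u₀ G y)) =ᶠ[𝓝 z] fun _ => 0 := by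
    filter_upwards [(isOpen_slitDom u₀).mem_nhds hz] with y hy using hG.fderiv_energy hF hy
  have hGpair : rep u₀ G =ᶠ[𝓝 z] fun y => (y.2, (rep u₀ G y).2) := by
    filter_upwards [(isOpen_slitDom u₀).mem_nhds hz] with y hy
    exact Prod.ext (hG.isSpray.rep_fst hy.1 (pt_mem_slit hy)) rfl
  -- Differentiate `dE(G) = 0` in the fibre direction `c`; the geodesic equation tested on `(c, 0)`
  -- then evaluates the Hessian term as the derivative of the energy along `(c, 0)`. The half sum is
  -- the horizontal lift.
  have h1 := fderiv_fderiv_apply he hGd (0, c)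
  rw [hev.fderiv_eq, fderiv_pair differentiableAt_snd hg hGpair] at h1
  have h2 := hG.chart_eq hF hu (c, 0)
  have h0 : ((0, 0) : E × E) = 0 := rfl
  rw [← hzdef, hF.fderiv_fderiv_radial hz, h0, map_zero, fderiv_fderiv_symm he] at h2
  have h3 : ∀ n : E, ((c, (1 / 2 : ℝ) • n) : E × E) =
      (1 / 2 : ℝ) • ((c, 0) + (c, n)) := by
    intro n
    refine Prod.ext ?_ ?_
    · simp only [Prod.smul_fst, Prod.fst_add]
      rw [← two_smul ℝ, smul_smul]; norm_num
    · simp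
  rw [h3, map_smul, map_add]
  simp [fderiv_snd] at h1 h2 ⊢
  linarith

/-- With `Φ = dE(γφ)`, the geodesic equation and concurrence turn `G(Φ)` into `dE` of the horizontal
lift of `φ` minus `C(E)`. The first term vanishes because the connection is conservative, and `C(E)
= 2E = F²`. -/
theorem IsConcurrent.fderiv_bigPhi_spray (hF : IsFinsler F)
    (hG : IsGeodesicSprayOn (slit E M) F G) (hφ : IsConcurrent F G φ) {u₀ : TM E M}
    (hu : u₀ ∈ slit E M) :
    fderiv ℝ (frep u₀ (bigPhi F φ)) (bchart u₀ u₀) (rep u₀ G (bchart u₀ u₀)) =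
      - (frep u₀ F (bchart u₀ u₀)) ^ 2 := by
  have hz := bchart_self_mem_slitDom hu
  set z := bchart u₀ u₀ with hzdef
  have he := hF.contDiffAt_energy hz
  have hg := hG.isSpray.contDiffAt hz.1 (pt_mem_slit hz)
  have hG1 : (rep u₀ G z).1 = z.2 := hG.isSpray.rep_fst hz.1 (pt_mem_slit hz)
  have h1 := hG.chart_eq hF hu (prep u₀ φ z, 0)
  have h0 : ((0, 0) : E × E) = 0 := rfl
  rw [← hzdef, hF.fderiv_fderiv_radial hz, h0, map_zero] at h1
  have h2 := hφ.fderiv_horizontal hG.isSpray hz z.2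
  have hev : (fun y : E × E => fderiv ℝ (fun y => (rep u₀ G y).2) y (0, y.2)) =ᶠ[𝓝 z]
      fun y => (2 : ℝ) • (rep u₀ G y).2 := by
    filter_upwards [(isOpen_slitDom u₀).mem_nhds hz] with y hy
      using hG.isSpray.fderiv_radial hy.1 (pt_mem_slit hy)
  have hd : DifferentiableAt ℝ (fun y : E × E => ((0, y.2) : E × E)) z := by fun_prop
  have h3 := fderiv_fderiv_apply hg hd (0, prep u₀ φ z)
  rw [hev.fderiv_eq, fderiv_fun_const_smul (hg.differentiableAt (by simp)),
    fderiv_pair (differentiableAt_const 0) differentiableAt_snd EventuallyEq.rfl] at h3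
  -- The fibre part of `G` has degree 2, so its vertical derivative has degree 1: contracting the
  -- connection coefficients with `y` gives back the derivative.
  have h4 : fderiv ℝ (fderiv ℝ (fun y => (rep u₀ G y).2)) z (0, prep u₀ φ z) (0, z.2) =
      fderiv ℝ (fun y => (rep u₀ G y).2) z (0, prep u₀ φ z) := by
    simp [fderiv_snd, two_smul] at h3
    exact h3.symm
  rw [h4, sub_eq_iff_eq_add] at h2
  have h5 := hG.fderiv_energy_horizontal hF hu (prep u₀ φ z)
  have hsplit : ∀ c n : E, ((c, n) : E × E) = (c, 0) + (0, n) := by simp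
  have hGz : rep u₀ G z = (z.2, 0) + (0, (rep u₀ G z).2) := by
    rw [← hsplit, ← hG1]
  have h6 : fderiv ℝ (prep u₀ φ) z (rep u₀ G z) = - z.2 +
      (1 / 2 : ℝ) • fderiv ℝ (fun y => (rep u₀ G y).2) z (0, prep u₀ φ z) := by
    rw [hGz, map_add, hφ.fderiv_vertical hG.isSpray hz, add_zero, h2]
  have h7 : ∀ m : E, ((0, -z.2 + m) : E × E) = (0, m) - (0, z.2) := by
    intro m
    refine Prod.ext (by simp) ?_
    simp only [Prod.snd_sub]; abel
  rw [← hzdef, hsplit, map_add] at h5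
  rw [hφ.fderiv_bigPhi hF hz, h6, h7, map_sub, hF.fderiv_energy_radial hz]
  have h8 : 2 * frep u₀ (energy F) z = frep u₀ F z ^ 2 := by simp only [frep, energy]; ring
  linarith

end BigPhi

/-! ### Euler relations, and the derivatives of the Matsumoto energy as a function of `F` and `Φ`.
-/

section Homogeneous

variable {V : Type*} [NormedAddCommGroup V] [NormedSpace ℝ V]

theorem hasFDerivAt_fun_div {f g : V → ℝ} {f' g' : V →L[ℝ] ℝ} {z : V} (hf : HasFDerivAt f f' z)
    (hg : HasFDerivAt g g' z) (h0 : g z ≠ 0) :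
    HasFDerivAt (fun y => f y / g y) (((g z) ^ 2)⁻¹ • (g z • f' - f z • g')) z := by
  have h := hf.mul ((hasDerivAt_inv h0).comp_hasFDerivAt z hg)
  refine (h.congr_of_eventuallyEq (Eventually.of_forall fun y => ?_)).congr_fderiv ?_
  · simp [div_eq_mul_inv]
  · ext a
    simp
    field_simp
    ring

/-- `f` is differentiable at `z` and satisfies Euler's relation of degree `k` in the
direction `v`. -/
def EulerAt (k : ℝ) (f : V → ℝ) (z v : V) : Prop :=
  DifferentiableAt ℝ f z ∧ fderiv ℝ f z v = k * f z

variable {k l : ℝ} {f g : V → ℝ} {z v : V}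

theorem EulerAt.mul (hf : EulerAt k f z v) (hg : EulerAt l g z v) :
    EulerAt (k + l) (fun y => f y * g y) z v := by
  refine ⟨hf.1.fun_mul hg.1, ?_⟩
  rw [fderiv_fun_mul hf.1 hg.1]
  simp [hf.2, hg.2]
  ring

theorem EulerAt.const_mul (hf : EulerAt k f z v) (c : ℝ) : EulerAt k (fun y => c * f y) z v := by
  refine ⟨hf.1.const_mul c, ?_⟩
  rw [fderiv_const_mul hf.1]
  simp [hf.2]
  ring

theorem EulerAt.add (hf : EulerAt k f z v) (hg : EulerAt k g z v) :
    EulerAt k (fun y => f y + g y) z v := by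
  refine ⟨hf.1.fun_add hg.1, ?_⟩
  rw [fderiv_fun_add hf.1 hg.1]
  simp [hf.2, hg.2]
  ring

theorem EulerAt.sub (hf : EulerAt k f z v) (hg : EulerAt k g z v) :
    EulerAt k (fun y => f y - g y) z v := by
  refine ⟨hf.1.fun_sub hg.1, ?_⟩
  rw [fderiv_fun_sub hf.1 hg.1]
  simp [hf.2, hg.2]
  ring

theorem EulerAt.div (hf : EulerAt k f z v) (hg : EulerAt l g z v) (h0 : g z ≠ 0) :
    EulerAt (k - l) (fun y => f y / g y) z v := by
  have h := hasFDerivAt_fun_div hf.1.hasFDerivAt hg.1.hasFDerivAt h0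
  refine ⟨h.differentiableAt, ?_⟩
  rw [h.fderiv]
  simp [hf.2, hg.2]
  field_simp

theorem EulerAt.const (c : ℝ) : EulerAt 0 (fun _ : V => c) z v := by
  refine ⟨differentiableAt_const c, by simp⟩

theorem hasFDerivAt_matsumoto_coeff_left {A P : V → ℝ} {A' P' : V →L[ℝ] ℝ} (hA : HasFDerivAt A A' z)
    (hP : HasFDerivAt P P' z) (h0 : A z - P z ≠ 0) :
    HasFDerivAt (fun y => A y ^ 3 * (A y - 2 * P y) / (A y - P y) ^ 3)
      ((A z ^ 2 * (A z ^ 2 - 4 * A z * P z + 6 * P z ^ 2) / (A z - P z) ^ 4) • A' +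
        (A z ^ 3 * (A z - 4 * P z) / (A z - P z) ^ 4) • P') z := by
  have h := hasFDerivAt_fun_div ((hA.pow 3).fun_mul (hA.fun_sub (hP.const_mul 2)))
    ((hA.fun_sub hP).pow 3)
    (pow_ne_zero 3 h0)
  refine h.congr_fderiv ?_
  ext a
  simp
  field_simp
  ring

theorem hasFDerivAt_matsumoto_coeff_right {A P : V → ℝ} {A' P' : V →L[ℝ] ℝ}
    (hA : HasFDerivAt A A' z) (hP : HasFDerivAt P P' z) (h0 : A z - P z ≠ 0) :
    HasFDerivAt (fun y => A y ^ 4 / (A y - P y) ^ 3)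
      ((A z ^ 3 * (A z - 4 * P z) / (A z - P z) ^ 4) • A' +
        (3 * A z ^ 4 / (A z - P z) ^ 4) • P') z := by
  have h := hasFDerivAt_fun_div (hA.pow 4) ((hA.fun_sub hP).pow 3) (pow_ne_zero 3 h0)
  refine h.congr_fderiv ?_
  ext a
  simp
  field_simp
  ring

theorem hasFDerivAt_matsumoto_energy {A P : V → ℝ} {A' P' : V →L[ℝ] ℝ} (hA : HasFDerivAt A A' z)
    (hP : HasFDerivAt P P' z) (h0 : A z - P z ≠ 0) :
    HasFDerivAt (fun y => (A y ^ 2 / (A y - P y)) ^ 2 / 2)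
      ((A z ^ 3 * (A z - 2 * P z) / (A z - P z) ^ 3) • A' +
        (A z ^ 4 / (A z - P z) ^ 3) • P') z := by
  have h := ((hasFDerivAt_fun_div (hA.pow 2) (hA.fun_sub hP) h0).pow 2).const_mul (2⁻¹ : ℝ)
  refine (h.congr_of_eventuallyEq (Eventually.of_forall fun y => ?_)).congr_fderiv ?_
  · simp; ring
  · ext a
    simp
    field_simp
    ring

/-- Second-order chain rule. The Hessians of `A` and `P` are kept as separate terms because they are
removed for different reasons: the geodesic equation and the closedness of `d_J Φ`. -/
theorem fderiv_fderiv_matsumoto_energy {A P : V → ℝ} (hA : ContDiffAt ℝ ∞ A z)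
    (hP : ContDiffAt ℝ ∞ P z) (h0 : A z - P z ≠ 0) (a c : V) :
    fderiv ℝ (fderiv ℝ (fun y => (A y ^ 2 / (A y - P y)) ^ 2 / 2)) z a c =
      (A z ^ 2 * (A z ^ 2 - 4 * A z * P z + 6 * P z ^ 2) / (A z - P z) ^ 4 * fderiv ℝ A z a +
        A z ^ 3 * (A z - 4 * P z) / (A z - P z) ^ 4 * fderiv ℝ P z a) * fderiv ℝ A z c +
      A z ^ 3 * (A z - 2 * P z) / (A z - P z) ^ 3 * fderiv ℝ (fderiv ℝ A) z a c +
      (A z ^ 3 * (A z - 4 * P z) / (A z - P z) ^ 4 * fderiv ℝ A z a +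
        3 * A z ^ 4 / (A z - P z) ^ 4 * fderiv ℝ P z a) * fderiv ℝ P z c +
      A z ^ 4 / (A z - P z) ^ 3 * fderiv ℝ (fderiv ℝ P) z a c := by
  have hAd := (hA.differentiableAt (by simp)).hasFDerivAt
  have hPd := (hP.differentiableAt (by simp)).hasFDerivAt
  have hne : ∀ᶠ y in 𝓝 z, A y - P y ≠ 0 :=
    (hA.continuousAt.sub hP.continuousAt).eventually_ne h0
  have hev : fderiv ℝ (fun y => (A y ^ 2 / (A y - P y)) ^ 2 / 2) =ᶠ[𝓝 z] fun y =>
      (A y ^ 3 * (A y - 2 * P y) / (A y - P y) ^ 3) • fderiv ℝ A y +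
        (A y ^ 4 / (A y - P y) ^ 3) • fderiv ℝ P y := by
    filter_upwards [hne, hA.eventually_differentiableAt, hP.eventually_differentiableAt]
      with y h1 h2 h3
    exact (hasFDerivAt_matsumoto_energy h2.hasFDerivAt h3.hasFDerivAt h1).fderiv
  have h := ((hasFDerivAt_matsumoto_coeff_left hAd hPd h0).fun_smul
    hA.differentiableAt_fderiv.hasFDerivAt).fun_add
    ((hasFDerivAt_matsumoto_coeff_right hAd hPd h0).fun_smul
      hP.differentiableAt_fderiv.hasFDerivAt)
  rw [hev.fderiv_eq, h.fderiv]
  simp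
  ring

/-- The algebraic identity behind the formula for the spray of a Matsumoto change. -/
theorem matsumoto_identity {A P Q α β τ σ w f₁ f₂ X Y : ℝ} (hA : A ≠ 0) (hD : A - P ≠ 0)
    (hN : A * (1 + 2 * Q) - 3 * P ≠ 0)
    (h₁ : f₁ = A * (4 * P - A) / (A * (1 + 2 * Q) - 3 * P))
    (h₂ : f₂ = 2 * A ^ 3 / (A * (1 + 2 * Q) - 3 * P))
    (hX : A * X = f₂ * P - f₁ * A ^ 2) (hY : Y = -A ^ 2 - f₁ * P + f₂ * Q)
    (hw : A * w = - f₁ * A * β + f₂ * σ - X * β) :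
    ((A ^ 2 * (A ^ 2 - 4 * A * P + 6 * P ^ 2) / (A - P) ^ 4 * X +
        A ^ 3 * (A - 4 * P) / (A - P) ^ 4 * Y) * β +
      A ^ 3 * (A - 2 * P) / (A - P) ^ 3 * w +
      (A ^ 3 * (A - 4 * P) / (A - P) ^ 4 * X + 3 * A ^ 4 / (A - P) ^ 4 * Y) * σ) -
    ((A ^ 2 * (A ^ 2 - 4 * A * P + 6 * P ^ 2) / (A - P) ^ 4 * α +
        A ^ 3 * (A - 4 * P) / (A - P) ^ 4 * τ) * A +
      (A ^ 3 * (A - 4 * P) / (A - P) ^ 4 * α + 3 * A ^ 4 / (A - P) ^ 4 * τ) * P) =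
    - (A ^ 3 * (A - 2 * P) / (A - P) ^ 3 * α + A ^ 4 / (A - P) ^ 3 * τ) := by
  -- Taking the denominator `N` as a variable and solving for `Q` makes everything rational with
  -- denominators `A`, `A - P` and `N` only.
  obtain ⟨N, hNdef⟩ : ∃ N, N = A * (1 + 2 * Q) - 3 * P := ⟨_, rfl⟩
  rw [← hNdef] at hN h₁ h₂
  have hQ : Q = (N + 3 * P - A) / (2 * A) := by
    field_simp
    linarith
  have hX' : X = (f₂ * P - f₁ * A ^ 2) / A := by field_simp; linarith
  have hw' : w = (- f₁ * A * β + f₂ * σ - X * β) / A := by field_simp; linarith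
  rw [hw', hY, hX', hQ, h₁, h₂]
  field_simp
  ring

end Homogeneous

/-! ### The geodesic spray of the Matsumoto change. -/

section Matsumoto

variable {E : Type*} [NormedAddCommGroup E] [NormedSpace ℝ E]
  {M : Type*} [TopologicalSpace M] [ChartedSpace E M] [IsManifold 𝓘(ℝ, E) ∞ M]
  {F : TM E M → ℝ} {G : (u : TM E M) → TTM u} {φ : (u : TM E M) → Pull u}

/-- The coefficient of `- C` in the spray of the Matsumoto change. -/
def liouvilleCoeff (F : TM E M → ℝ) (φ : (u : TM E M) → Pull u) (u : TM E M) : ℝ :=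
  F u * (4 * bigPhi F φ u - F u) / (F u * (1 + 2 * pSq F φ u) - 3 * bigPhi F φ u)

/-- The coefficient of `γ φ` in the spray of the Matsumoto change. -/
def concurrentCoeff (F : TM E M → ℝ) (φ : (u : TM E M) → Pull u) (u : TM E M) : ℝ :=
  2 * F u ^ 3 / (F u * (1 + 2 * pSq F φ u) - 3 * bigPhi F φ u)

/-- The spray of the Matsumoto change. -/
def matsumotoSpray (F : TM E M → ℝ) (G : (u : TM E M) → TTM u) (φ : (u : TM E M) → Pull u)
    (u : TM E M) : TTM u :=
  G u - liouvilleCoeff F φ u • liouville u + concurrentCoeff F φ u • gam u (φ u)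

/-- As `Φ = F · dF(γφ)`, a zero of `F` is a zero of `Φ`, contrary to `Φ < F`. Positivity is needed
to divide by `F`. -/
theorem IsFinsler.pos_of_mem_matsumotoDomain (hF : IsFinsler F) {u : TM E M}
    (hu : u ∈ matsumotoDomain F φ) : 0 < F u := by
  refine lt_of_le_of_ne (hF.nonneg u) fun h0 => ?_
  have hz := bchart_self_mem_slitDom hu.1
  have h1 := hF.frep_bigPhi (φ := φ) hz
  rw [fderiv_energy ((hF.contDiffAt hz).differentiableAt (by simp))] at h1
  simp only [frep, pt_bchart_self] at h1
  rw [← h0, zero_mul] at h1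
  have h2 := hu.2
  rw [h1, ← h0] at h2
  exact lt_irrefl _ h2

theorem rep_matsumotoSpray {u₀ : TM E M} {z : E × E} (hz : z ∈ (bchart u₀).target) :
    rep u₀ (matsumotoSpray F G φ) z = rep u₀ G z
      - frep u₀ (liouvilleCoeff F φ) z • ((0, z.2) : E × E)
      + frep u₀ (concurrentCoeff F φ) z • ((0, prep u₀ φ z) : E × E) := by
  change coord u₀ (pt u₀ z) (_ - _ + _) = _
  rw [map_add, map_sub, map_smul, map_smul, ← rep_liouville hz]
  have h : coord u₀ (pt u₀ z) (gam (pt u₀ z) (φ (pt u₀ z))) = (0, prep u₀ φ z) := rep_gam hz φ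
  rw [h]
  rfl

theorem eventually_mem_of_isOpen {D : Set (TM E M)} (hD : IsOpen D) {u : TM E M} (hu : u ∈ D) :
    ∀ᶠ y in 𝓝 (bchart u u), pt u y ∈ D := by
  have hz : bchart u u ∈ (bchart u).target := (bchart u).map_source (mem_bchart_source u)
  have h := (contMDiffAt_pt hz).continuousAt.tendsto
  rw [pt_bchart_self] at h
  exact h.eventually (hD.mem_nhds hu)

theorem eq_of_hilbert_eq (hFhat : IsConicPseudoFinsler (matsumotoDomain F φ) (matsumoto F φ))
    {u : TM E M} (hu : u ∈ matsumotoDomain F φ) {a a' : TTM u}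
    (h : ∀ b, hilbertForm (matsumoto F φ) u a b = hilbertForm (matsumoto F φ) u a' b) :
    a = a' := by
  rw [← sub_eq_zero]
  refine hFhat.nondegenerate u hu _ fun b => ?_
  have hev : ∀ᶠ v in 𝓝 u, ContMDiffAt 𝓘(ℝ, E).tangent 𝓘(ℝ, ℝ) ∞ (matsumoto F φ) v := by
    filter_upwards [hFhat.isOpen.mem_nhds hu] with v hv using hFhat.smooth v hv
  have h1 := h b
  -- Linearity in the first argument becomes visible in the coordinate formula, which requires
  -- smoothness near `u`.
  rw [hilbertForm_eq hev, hilbertForm_eq hev] at h1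
  rw [hilbertForm_eq hev, map_sub, map_sub]
  have h2 : ((0, (coord u u a - coord u u a').1) : E × E) =
    (0, (coord u u a).1) - (0, (coord u u a').1) := by simp
  rw [h2, map_sub, sub_apply]
  linarith

variable [CompleteSpace E]

/-- Collects the inputs of `matsumoto_identity`: there `X` and `Y` are the derivatives of `F` and
`Φ` along the new spray, `α` and `τ` those along `b`, `β` and `σ` those along `J b`, and `w` is
`dd_J F` evaluated on the new spray and `b`. -/
theorem matsumotoSpray_hilbert_eq (hF : IsFinsler F) (hG : IsGeodesicSprayOn (slit E M) F G)
    (hφ : IsConcurrent F G φ)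
    (hFhat : IsConicPseudoFinsler (matsumotoDomain F φ) (matsumoto F φ)) {u : TM E M}
    (hu : u ∈ matsumotoDomain F φ)
    (hN : F u * (1 + 2 * pSq F φ u) - 3 * bigPhi F φ u ≠ 0) (b : TTM u) :
    hilbertForm (matsumoto F φ) u (matsumotoSpray F G φ u) b =
      - dFun (energy (matsumoto F φ)) u b := by
  have hz := bchart_self_mem_slitDom hu.1
  have hE := hG.chart_eq hF hu.1 (coord u u b)
  have hP := hφ.fderiv_bigPhi_spray hF hG hu.1
  have hrep := rep_matsumotoSpray (F := F) (G := G) (φ := φ) hz.1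
  have hev : ∀ᶠ v in 𝓝 u, ContMDiffAt 𝓘(ℝ, E).tangent 𝓘(ℝ, ℝ) ∞ (matsumoto F φ) v := by
    filter_upwards [hFhat.isOpen.mem_nhds hu] with v hv using hFhat.smooth v hv
  rw [hilbertForm_eq hev, ← rep_bchart_self,
    dFun_self ((contMDiffAt_energy (hFhat.smooth u hu)).mdifferentiableAt (by simp))]
  have hfirst : (rep u (matsumotoSpray F G φ) (bchart u u)).1 = (bchart u u).2 := by
    rw [hrep, ← hG.isSpray.rep_fst hz.1 (pt_mem_slit hz)]
    simp
  rw [hfirst]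
  have hval : ∀ f : TM E M → ℝ, frep u f (bchart u u) = f u := fun f =>
    congrArg f (pt_bchart_self u)
  set z := bchart u u with hzdef
  set β := coord u u b
  have hApos : 0 < frep u F z := by
    rw [hval]; exact hF.pos_of_mem_matsumotoDomain hu
  have hD : frep u F z - frep u (bigPhi F φ) z ≠ 0 := by
    rw [hval, hval]; exact (sub_pos.2 hu.2).ne'
  rw [← hval F, ← hval (pSq F φ), ← hval (bigPhi F φ)] at hN
  have hA := hF.contDiffAt hz
  have hPc := hφ.contDiffAt_bigPhi hF hz
  have hAd := hA.differentiableAt (by simp)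
  have he := hF.contDiffAt_energy hz
  have h₁ : frep u (liouvilleCoeff F φ) z = frep u F z * (4 * frep u (bigPhi F φ) z - frep u F z) /
    (frep u F z * (1 + 2 * frep u (pSq F φ) z) - 3 * frep u (bigPhi F φ) z) := rfl
  have h₂ : frep u (concurrentCoeff F φ) z = 2 * frep u F z ^ 3 /
    (frep u F z * (1 + 2 * frep u (pSq F φ) z) - 3 * frep u (bigPhi F φ) z) := rfl
  have hEF : frep u (energy (matsumoto F φ)) =
    fun y => (frep u F y ^ 2 / (frep u F y - frep u (bigPhi F φ) y)) ^ 2 / 2 := rfl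
  have hAφ : frep u F z * fderiv ℝ (frep u F) z (0, prep u φ z) = frep u (bigPhi F φ) z := by
    rw [hF.frep_bigPhi hz, fderiv_energy hAd]
  have hAG : frep u F z * fderiv ℝ (frep u F) z (rep u G z) = 0 := by
    rw [← fderiv_energy hAd, hG.fderiv_energy hF hz]
  have hX : frep u F z * fderiv ℝ (frep u F) z (rep u (matsumotoSpray F G φ) z) =
      frep u (concurrentCoeff F φ) z * frep u (bigPhi F φ) z -
      frep u (liouvilleCoeff F φ) z * frep u F z ^ 2 := by
    rw [hrep, map_add, map_sub, map_smul, map_smul, hF.fderiv_radial hz, smul_eq_mul, smul_eq_mul]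
    linear_combination hAG + frep u (concurrentCoeff F φ) z * hAφ
  have hY : fderiv ℝ (frep u (bigPhi F φ)) z (rep u (matsumotoSpray F G φ) z) =
      - frep u F z ^ 2 - frep u (liouvilleCoeff F φ) z * frep u (bigPhi F φ) z +
      frep u (concurrentCoeff F φ) z * frep u (pSq F φ) z := by
    rw [hrep, map_add, map_sub, map_smul, map_smul, hφ.fderiv_bigPhi_radial hF hG.isSpray hz,
      hφ.frep_pSq hF hG.isSpray hz, hP, smul_eq_mul, smul_eq_mul]
  have hDe : ∀ a c : E × E, fderiv ℝ (fderiv ℝ (frep u (energy F))) z a c =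
      fderiv ℝ (frep u F) z a * fderiv ℝ (frep u F) z c +
      frep u F z * fderiv ℝ (fderiv ℝ (frep u F)) z a c := by
    intro a c
    have hev : (fun y => fderiv ℝ (frep u (energy F)) y c) =ᶠ[𝓝 z] fun y =>
        frep u F y * fderiv ℝ (frep u F) y c := by
      filter_upwards [hA.eventually_differentiableAt] with y hy using fderiv_energy hy c
    have hdc : DifferentiableAt ℝ (fun y => fderiv ℝ (frep u F) y c) z :=
      hA.differentiableAt_fderiv.clm_apply (differentiableAt_const c)
    rw [← fderiv_fderiv_const he, hev.fderiv_eq, fderiv_fun_mul hAd hdc]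
    simp [fderiv_fderiv_const hA]
    ring
  -- From `D²E = dF ⊗ dF + F D²F` and the geodesic equation of `F`: the correction by `C` and `γφ`
  -- adds multiples of `d_J E` and `d_J Φ`, and the `dF` terms cancel.
  have hw : frep u F z * (fderiv ℝ (fderiv ℝ (frep u F)) z (rep u (matsumotoSpray F G φ) z)
        (0, β.1) - fderiv ℝ (fderiv ℝ (frep u F)) z β (0, z.2)) =
      - frep u (liouvilleCoeff F φ) z * frep u F z * fderiv ℝ (frep u F) z (0, β.1) +
      frep u (concurrentCoeff F φ) z * fderiv ℝ (frep u (bigPhi F φ)) z (0, β.1) -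
      fderiv ℝ (frep u F) z (rep u (matsumotoSpray F G φ) z) * fderiv ℝ (frep u F) z (0, β.1) := by
    have k1 := hDe (rep u (matsumotoSpray F G φ) z) (0, β.1)
    have k2 := hDe β (0, z.2)
    have k3 : fderiv ℝ (fderiv ℝ (frep u (energy F))) z (rep u (matsumotoSpray F G φ) z) (0, β.1) =
        fderiv ℝ (fderiv ℝ (frep u (energy F))) z (rep u G z) (0, β.1)
        - frep u (liouvilleCoeff F φ) z * (frep u F z * fderiv ℝ (frep u F) z (0, β.1))
        + frep u (concurrentCoeff F φ) z * fderiv ℝ (frep u (bigPhi F φ)) z (0, β.1) := by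
      have k4 : fderiv ℝ (fderiv ℝ (frep u (energy F))) z (0, z.2) (0, β.1) =
          frep u F z * fderiv ℝ (frep u F) z (0, β.1) := by
        rw [fderiv_fderiv_symm he, hF.fderiv_fderiv_radial hz, fderiv_energy hAd]
        ring
      rw [hφ.fderiv_bigPhi_vertical hF hG.isSpray hz, ← k4, hrep, map_add, map_sub, map_smul,
        map_smul]
      simp
    rw [hF.fderiv_radial hz] at k2
    rw [fderiv_energy hAd] at hE
    linear_combination -k1 + k2 + k3 + hE
  have key := matsumoto_identity (α := fderiv ℝ (frep u F) z β)
    (τ := fderiv ℝ (frep u (bigPhi F φ)) z β) hApos.ne' hD hN h₁ h₂ hX hY hw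
  -- Closedness of `d_J Φ`: the two Hessian terms of `Φ` are equal and carry the same coefficient,
  -- so they cancel.
  have hsymm := hφ.fderiv_fderiv_bigPhi_symm hF hG.isSpray hz
    (rep u (matsumotoSpray F G φ) z) β
  rw [hfirst] at hsymm
  rw [hEF, fderiv_fderiv_matsumoto_energy hA hPc hD, fderiv_fderiv_matsumoto_energy hA hPc hD,
    (hasFDerivAt_matsumoto_energy hAd.hasFDerivAt
      (hPc.differentiableAt (by simp)).hasFDerivAt hD).fderiv, hsymm, hF.fderiv_radial hz,
    hφ.fderiv_bigPhi_radial hF hG.isSpray hz]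
  simp only [add_apply, smul_apply, smul_eq_mul]
  linear_combination key

/-- The corrections are vertical, so `J Ĝ = C`, and they have degree 2 in `y`, so `[C, Ĝ] = Ĝ`. The
field is prescribed on the domain only; openness makes its germ there the expected one. -/
theorem isSprayOn_matsumoto (hF : IsFinsler F) (hG : IsGeodesicSprayOn (slit E M) F G)
    (hφ : IsConcurrent F G φ) (hopen : IsOpen (matsumotoDomain F φ))
    (hN : ∀ u ∈ matsumotoDomain F φ, F u * (1 + 2 * pSq F φ u) - 3 * bigPhi F φ u ≠ 0)
    {Ghat : (u : TM E M) → TTM u}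
    (hGhat : ∀ u ∈ matsumotoDomain F φ, Ghat u = matsumotoSpray F G φ u) :
    IsSprayOn (matsumotoDomain F φ) Ghat := by
  have hfst : ∀ u ∈ matsumotoDomain F φ, ∀ y ∈ slitDom u, pt u y ∈ matsumotoDomain F φ →
      rep u Ghat y = (y.2, (rep u G y).2 - frep u (liouvilleCoeff F φ) y • y.2 +
        frep u (concurrentCoeff F φ) y • prep u φ y) := by
    intro u hu y hy hyD
    have h1 : rep u Ghat y = rep u (matsumotoSpray F G φ) y :=
      congrArg (coord u (pt u y)) (hGhat _ hyD)
    rw [h1, rep_matsumotoSpray hy.1]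
    refine Prod.ext ?_ ?_
    · rw [← hG.isSpray.rep_fst hy.1 (pt_mem_slit hy)]
      simp
    · simp
  have hev : ∀ u ∈ matsumotoDomain F φ, rep u Ghat =ᶠ[𝓝 (bchart u u)] fun y =>
      (y.2, (rep u G y).2 - frep u (liouvilleCoeff F φ) y • y.2 +
        frep u (concurrentCoeff F φ) y • prep u φ y) := by
    intro u hu
    filter_upwards [(isOpen_slitDom u).mem_nhds (bchart_self_mem_slitDom hu.1),
      eventually_mem_of_isOpen hopen hu] with y hy hyD using hfst u hu y hy hyD
  have hne : ∀ u ∈ matsumotoDomain F φ, frep u F (bchart u u) *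
      (1 + 2 * frep u (pSq F φ) (bchart u u)) - 3 * frep u (bigPhi F φ) (bchart u u) ≠ 0 := by
    intro u hu
    simp only [frep, pt_bchart_self]
    exact hN u hu
  have hsmooth : ∀ u ∈ matsumotoDomain F φ, SmoothFieldAt Ghat u := by
    intro u hu
    have hz := bchart_self_mem_slitDom hu.1
    have hA := hF.contDiffAt hz
    have hP := hφ.contDiffAt_bigPhi hF hz
    have hQ := hφ.contDiffAt_pSq hF hG.isSpray hz
    have hden := (hA.mul (contDiffAt_const (c := (1 : ℝ)) |>.add
      (contDiffAt_const (c := (2 : ℝ)) |>.mul hQ))).sub (contDiffAt_const (c := (3 : ℝ)) |>.mul hP)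
    have hc1 : ContDiffAt ℝ ∞ (frep u (liouvilleCoeff F φ)) (bchart u u) :=
      (hA.mul ((contDiffAt_const (c := (4 : ℝ)) |>.mul hP).sub hA)).div hden (hne u hu)
    have hc2 : ContDiffAt ℝ ∞ (frep u (concurrentCoeff F φ)) (bchart u u) :=
      (contDiffAt_const (c := (2 : ℝ)) |>.mul (hA.pow 3)).div hden (hne u hu)
    have h := smoothFieldAt_of_contDiffAt_rep (V := Ghat) hz.1
      (ContDiffAt.congr_of_eventuallyEq
        (contDiffAt_snd.prodMk (((hG.isSpray.contDiffAt hz.1 (pt_mem_slit hz)).sub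
          (hc1.smul contDiffAt_snd)).add (hc2.smul (hφ.contDiffAt hz)))) (hev u hu))
    rwa [pt_bchart_self] at h
  refine ⟨hsmooth, fun u hu => ?_, fun u hu => ?_⟩
  · have hz := bchart_self_mem_slitDom hu.1
    have h := (rep_fst_of_vertJ (V := Ghat) hz.1).2
      (by rw [hfst u hu _ hz (by rwa [pt_bchart_self])])
    rwa [pt_bchart_self] at h
  · have hz := bchart_self_mem_slitDom hu.1
    have hsm : SmoothFieldAt Ghat (pt u (bchart u u)) := by
      rw [pt_bchart_self]; exact hsmooth u hu
    have hrep := rep_bracket_liouville hz.1 hsm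
    have hvalue := hfst u hu _ hz (by rwa [pt_bchart_self])
    -- Degrees in `y`: `F` and `Φ` have degree 1 and `p²` has degree 0, so the common denominator
    -- has degree 1 and the coefficients of `C` and `γφ` have degrees 1 and 2.
    have hA : EulerAt 1 (frep u F) (bchart u u) (0, (bchart u u).2) :=
      ⟨(hF.contDiffAt hz).differentiableAt (by simp), by rw [hF.fderiv_radial hz, one_mul]⟩
    have hP : EulerAt 1 (frep u (bigPhi F φ)) (bchart u u) (0, (bchart u u).2) :=
      ⟨(hφ.contDiffAt_bigPhi hF hz).differentiableAt (by simp),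
        by rw [hφ.fderiv_bigPhi_radial hF hG.isSpray hz, one_mul]⟩
    have hQ : EulerAt 0 (frep u (pSq F φ)) (bchart u u) (0, (bchart u u).2) :=
      ⟨(hφ.contDiffAt_pSq hF hG.isSpray hz).differentiableAt (by simp),
        by rw [hφ.fderiv_pSq_vertical hF hG.isSpray hz, zero_mul]⟩
    have hden := (hA.mul ((EulerAt.const 1).add (hQ.const_mul 2)))
    rw [add_zero] at hden
    replace hden := hden.sub (hP.const_mul 3)
    have hc1 : EulerAt (1 + 1 - 1) (frep u (liouvilleCoeff F φ)) (bchart u u)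
        (0, (bchart u u).2) := (hA.mul ((hP.const_mul 4).sub hA)).div hden (hne u hu)
    have hcube : EulerAt (1 + 1 + 1) (fun y => 2 * frep u F y ^ 3) (bchart u u)
        (0, (bchart u u).2) := by
      have := ((hA.mul hA).mul hA).const_mul 2
      convert! this using 2
      ring
    have hc2 : EulerAt (1 + 1 + 1 - 1) (frep u (concurrentCoeff F φ)) (bchart u u)
        (0, (bchart u u).2) := hcube.div hden (hne u hu)
    have hg := (hG.isSpray.contDiffAt hz.1 (pt_mem_slit hz)).differentiableAt (by simp)
    have hf := (hφ.contDiffAt hz).differentiableAt (by simp)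
    have hgr := hG.isSpray.fderiv_radial hz.1 (pt_mem_slit hz)
    have hd1 := (hc1.1.hasFDerivAt.fun_smul (hasFDerivAt_snd (𝕜 := ℝ) (p := bchart u u)))
    have hd2 := (hc2.1.hasFDerivAt.fun_smul hf.hasFDerivAt)
    have hd := (hg.hasFDerivAt.fun_sub hd1).fun_add hd2
    rw [fderiv_pair differentiableAt_snd hd.differentiableAt (hev u hu), hd.fderiv, hvalue] at hrep
    have hfin : rep u (bracket liouville Ghat) (bchart u u) = rep u Ghat (bchart u u) := by
      rw [hrep, hvalue]
      refine Prod.ext ?_ ?_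
      · simp [fderiv_snd]
      · simp only [Prod.snd_sub, add_apply, sub_apply, smul_apply,
          ContinuousLinearMap.smulRight_apply, ContinuousLinearMap.coe_snd', hc1.2, hc2.2, hgr,
          hφ.fderiv_vertical hG.isSpray hz]
        module
    rw [rep_bchart_self, rep_bchart_self, coord_self, coord_self] at hfin
    exact hfin

end Matsumoto

end Finsler

end

theorem mainTheorem2
    {E : Type*} [NormedAddCommGroup E] [NormedSpace ℝ E] [FiniteDimensional ℝ E]
    {M : Type*} [TopologicalSpace M] [T2Space M] [ParacompactSpace M] [ChartedSpace E M]
    [IsManifold 𝓘(ℝ, E) ∞ M]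
    (F : Finsler.TM E M → ℝ) (hF : Finsler.IsFinsler F)
    (G : (u : Finsler.TM E M) → Finsler.TTM u)
    (hG : Finsler.IsGeodesicSprayOn (Finsler.slit E M) F G)
    (φ : (u : Finsler.TM E M) → Finsler.Pull u) (hφ : Finsler.IsConcurrent F G φ)
    (hFhat : Finsler.IsConicPseudoFinsler (Finsler.matsumotoDomain F φ) (Finsler.matsumoto F φ))
    (hdenom : ∀ u ∈ Finsler.matsumotoDomain F φ,
      F u * (1 + 2 * Finsler.pSq F φ u) - 3 * Finsler.bigPhi F φ u ≠ 0)
    (Ghat : (u : Finsler.TM E M) → Finsler.TTM u) :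
    Finsler.IsGeodesicSprayOn (Finsler.matsumotoDomain F φ) (Finsler.matsumoto F φ) Ghat ↔
      ∀ u ∈ Finsler.matsumotoDomain F φ, Ghat u =
        G u
          - (F u * (4 * Finsler.bigPhi F φ u - F u) /
              (F u * (1 + 2 * Finsler.pSq F φ u) - 3 * Finsler.bigPhi F φ u)) • Finsler.liouville u
          + (2 * F u ^ 3 /
              (F u * (1 + 2 * Finsler.pSq F φ u) - 3 * Finsler.bigPhi F φ u)) •
            Finsler.gam u (φ u) := by
  have : CompleteSpace E := FiniteDimensional.complete ℝ E
  constructor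
  · intro h u hu
    -- Uniqueness uses the geodesic equation only, pointwise; the spray conditions play no part.
    refine Finsler.eq_of_hilbert_eq (a' := Finsler.matsumotoSpray F G φ u) hFhat hu fun b => ?_
    rw [h.hilbert_eq u hu,
      Finsler.matsumotoSpray_hilbert_eq hF hG hφ hFhat hu (hdenom u hu)]
  · intro h
    refine ⟨Finsler.isSprayOn_matsumoto hF hG hφ hFhat.isOpen hdenom h, fun u hu b => ?_⟩
    have h1 : Ghat u = Finsler.matsumotoSpray F G φ u := h u hu
    rw [h1]
    exact Finsler.matsumotoSpray_hilbert_eq hF hG hφ hFhat hu (hdenom u hu) b
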